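/- Fix $n$ users holding bits $x_1,\dots,x_n\in\{0,1\}$, an odd positive integer $d$, a real $s>1$ and $p\in[0,1]$. Let $\nu_{d,s}$ be the truncated discrete Laplace distribution on $\{0,1,\dots,d\}$, $\nu_{d,s}(z)\propto e^{-|z-d/2|/s}$. The randomizer $R_{d,s,p}$ acts on a bit $x$ as follows: with probability $1-p$ it outputs $\frac{d-1}{2}+x$ ones and $\frac{d+1}{2}-x$ zeros; with probability $p$ it draws $z\sim\nu_{d,s}$ and outputs $z$ ones and $d-z$ zeros. Each user applies $R_{d,s,p}$ to their own bit with independent private randomness; a shuffler applies a uniformly random permutation to the concatenation of all $dn$ one-bit messages; and the analyzer outputs $A=\frac n2+\sum_{y}\left(y-\frac12\right)$, the sum being over all received bits $y$. The protocol is $\varepsilon$-DP in the shuffled model if for all datasets $X,X'\in\{0,1\}^n$ that differ in one user's bit and every set $\mathcal S$ of possible shuffler outputs, the probability that the shuffler output lies in $\mathcal S$ on input $X$ is at most $e^{\varepsilon}$ times the probability of the same event on input $X'$. **Theorem.** There is $n_0\in\mathbb N$ such that for every $C>0$ there is a constant $K>0$ (depending only on $C$) with the following property. For every $n\ge n_0$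 and every $\varepsilon$ with $n^{-2/3}<\varepsilon\le C$ there are an odd $d\in\mathbb N$, a real $s>1$ and $p\in[0,1]$ such that the (non-interactive) protocol above * is $\varepsilon$-DP in the shuffled model, * has every user send exactly $d\le K\,\frac{\log n}{\varepsilon}$ one-bit messages, and * has, for every input $x\in\{0,1\}^n$, expected absolute error $$\mathbb E\left|A-\sum_{i=1}^n x_i\right|\;\le\; K\cdot\frac{\sqrt{\max\{1,\log(1/\varepsilon)\}}}{\varepsilon^{3/2}} .$$ -/

import Mathlib

open scoped ENNReal NNReal

noncomputable section

namespace ShuffledDP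

/-- Two datasets of `n` users are neighbouring if they differ in the data of at most one user. -/
def Neighbors {X : Type*} {n : ℕ} (x x' : Fin n → X) : Prop :=
  ∃ i, ∀ j, j ≠ i → x j = x' j

/-- Pure differential privacy of a randomized algorithm: `Pr[M x ∈ S] ≤ e^ε · Pr[M x' ∈ S]` for all
neighbouring datasets `x, x'` and every set `S` of transcripts. -/
def IsPureDP {X Y : Type*} {n : ℕ} (ε : ℝ) (M : (Fin n → X) → PMF Y) : Prop :=
  ∀ x x' : Fin n → X, Neighbors x x' → ∀ S : Set Y,
    (M x).toOuterMeasure S ≤ ENNReal.ofReal (Real.exp ε) * (M x').toOuterMeasure S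

/-- Run the local randomizer `R` independently on every entry of a list of inputs and concatenate
the produced message sequences. -/
def runUsers {X Msg : Type*} (R : X → PMF (List Msg)) : List X → PMF (List Msg)
  | [] => PMF.pure []
  | x :: xs => (R x).bind fun m => (runUsers R xs).map fun ms => m ++ ms

/-- The shuffler: a uniformly random permutation of a sequence of messages. -/
def shuffler {Msg : Type*} (l : List Msg) : PMF (List Msg) :=
  (PMF.uniformOfFintype (Equiv.Perm (Fin l.length))).map fun σ => List.ofFn fun i => l.get (σ i)

/-- A (one-round, non-interactive) protocol in the shuffled model, given by the local randomizer
that every user applies to their own input with private randomness, and by the analyzer (here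
deterministic), which receives the shuffled sequence of all messages. -/
structure Protocol (X Msg Out : Type*) where
  randomizer : X → PMF (List Msg)
  analyzer : List Msg → Out

/-- The distribution of the output of the shuffler, which is the input of the analyzer. -/
def Protocol.view {X Msg Out : Type*} (P : Protocol X Msg Out) {n : ℕ} (x : Fin n → X) :
    PMF (List Msg) :=
  (runUsers P.randomizer (List.ofFn x)).bind shuffler

/-- A protocol for `n` users is `ε`-DP in the shuffled model if the output of its shuffler is. -/
def Protocol.IsShuffledDP {X Msg Out : Type*} (P : Protocol X Msg Out) (n : ℕ) (ε : ℝ) : Prop :=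
  IsPureDP ε fun x : Fin n → X => P.view x

/-- Every user always sends exactly `m` messages. -/
def Protocol.Sends {X Msg Out : Type*} (P : Protocol X Msg Out) (m : ℕ) : Prop :=
  ∀ x, ∀ l ∈ (P.randomizer x).support, l.length = m

/-- The sum of the input bits. -/
def bitSum {n : ℕ} (x : Fin n → Bool) : ℝ := ∑ i, if x i then 1 else 0

/-- The expected absolute error of a protocol for summation on the dataset `x`. -/
def Protocol.expectedError {Msg : Type*} (P : Protocol Bool Msg ℝ) {n : ℕ} (x : Fin n → Bool) :
    ℝ≥0∞ :=
  ∑' v, P.view x v * ENNReal.ofReal |P.analyzer v - bitSum x|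

/-- The Bernoulli distribution: `true` (one) with probability `p`. -/
def coin (p : ℝ≥0) (hp : p ≤ 1) : PMF Bool :=
  PMF.ofFintype (fun b => if b then (p : ℝ≥0∞) else 1 - (p : ℝ≥0∞)) (by simp [hp])

/-- The weight `e^{-|z - d/2| / s}` of `z ∈ {0, …, d}`. -/
def laplaceWeight (d : ℕ) (s : ℝ) (z : Fin (d + 1)) : ℝ≥0∞ :=
  ENNReal.ofReal (Real.exp (-|((z : ℕ) : ℝ) - (d : ℝ) / 2| / s))

/-- The discrete Laplace distribution with mean `d/2` and inverse scaling exponent `s`, truncated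
to the window of width `d` around its mean, which contains the integers `0, …, d`. -/
def truncLaplace (d : ℕ) (s : ℝ) : PMF (Fin (d + 1)) :=
  PMF.normalize (laplaceWeight d s)
    (by
      rw [Ne, ENNReal.tsum_eq_zero]
      intro h
      have h0 := h 0
      simp only [laplaceWeight, ENNReal.ofReal_eq_zero] at h0
      exact absurd h0 (not_le.2 (Real.exp_pos _)))
    (by
      rw [tsum_fintype]
      exact ENNReal.sum_ne_top.2 fun _ _ => ENNReal.ofReal_ne_top)

/-- A sequence of `a` ones followed by `b` zeros. -/
def bits (a b : ℕ) : List Bool := List.replicate a true ++ List.replicate b false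

/-- The randomizer: with probability `1 - p` it sends the near-balanced message for the input bit,
otherwise it sends `z` ones and `d - z` zeros for truncated discrete Laplace noise `z`. -/
def binaryRandomizer (d : ℕ) (s : ℝ) (p : ℝ≥0) (hp : p ≤ 1) (x : Bool) : PMF (List Bool) :=
  (coin p hp).bind fun a =>
    if a then (truncLaplace d s).map fun z : Fin (d + 1) => bits (z : ℕ) (d - (z : ℕ))
    else PMF.pure (if x then bits ((d + 1) / 2) ((d - 1) / 2) else bits ((d - 1) / 2) ((d + 1) / 2))

/-- The analyzer: `n/2 + ∑_{y ∈ R} (y - 1/2)`. -/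
def binaryAnalyzer (n : ℕ) (R : List Bool) : ℝ :=
  (n : ℝ) / 2 + (R.map fun y => (if y then (1 : ℝ) else 0) - 1 / 2).sum

/-- The binary summation protocol for `n` users with message number `d`, inverse scaling exponent
`s` and noise probability `p`. -/
def binarySummation (n d : ℕ) (s : ℝ) (p : ℝ≥0) (hp : p ≤ 1) : Protocol Bool Bool ℝ where
  randomizer := binaryRandomizer d s p hp
  analyzer := binaryAnalyzer n

end ShuffledDP

end

/-! ### The coefficientwise order on real polynomials. -/

namespace ShuffledDP

open Polynomial

/-! Shuffled bits carry no more information than their number of ones. With `d = 2m + 1`, a user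
with input `b` contributes `userPoly b = α X^(m+b) + noisePoly`. Here `α = 1 - p`, and the noise
puts weight `κ r^v` on `m - v` and on `m + 1 + v` for `0 ≤ v ≤ m`. Counts of independent users
multiply as polynomials, so privacy becomes the coefficientwise inequality `userPoly 0 * W ≤ (1 + ε)
userPoly 1 * W`, where `W` is the product over the other users (`userPoly_zero_mul_le`). The
opposite inequality is its mirror image under `X^i ↦ X^(2m+1-i)` (`userPoly_one_mul_le`).

The inequality reduces to bounding `α X^m W` by `(1 + O(ε)) α X^(m+1) W`, plus small multiples of
`noisePoly * W` and of `α X^m W` itself (`userPoly_pow_mul_le`). The product `W` is expanded by the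
number of users with upper noise (above `m`) among those with input 0 and those with input 1.

If many users remain in one group, `good_binomial` expands that group by the number `i` of
lower-noise users. - For large `i`, the counts `comps` of vectors in `{0, …, m}^i` either change
slowly between neighbouring sums, or grow so steeply that the user's own noise dominates
(`good_lapLeft_pow`). - For small positive `i`, one noisy value is shifted by one at cost `r⁻¹`.
Shifts blocked by the truncation are charged to configurations with one more noisy user
(`binomTerm_le`). - The case `i = 0` is charged to configurations with some noise
(`binomTerm_head_le`).

If nearly everybody has upper noise, either the counts are again slowly varying or making `h` of
these users non-noisy gives far heavier configurations (`plusTerm_le`).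

For accuracy, `n κ = 40 log(1/ε)` and `1 - r` is of order `ε`. The total noise then has variance
`O(log(1/ε) / ε³)` and bias `O(log(1/ε) / ε)`, so its second moment about the true sum gives the
error bound (`expectedError_le`). -/

/-- Coefficientwise comparison of real polynomials. -/
def CoeffLE (P Q : ℝ[X]) : Prop := ∀ k, P.coeff k ≤ Q.coeff k

infix:50 " ≤ᶜ " => CoeffLE

namespace CoeffLE

variable {P Q S T : ℝ[X]}

theorem refl (P : ℝ[X]) : P ≤ᶜ P := fun _ => le_rfl

theorem trans (h : P ≤ᶜ Q) (h' : Q ≤ᶜ S) : P ≤ᶜ S := fun k => (h k).trans (h' k)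

theorem add (h : P ≤ᶜ Q) (h' : S ≤ᶜ T) : P + S ≤ᶜ Q + T := fun k => by
  simpa using add_le_add (h k) (h' k)

theorem zero_le_add (h : 0 ≤ᶜ P) (h' : 0 ≤ᶜ Q) : 0 ≤ᶜ P + Q := by
  simpa using h.add h'

theorem mul_left (hS : 0 ≤ᶜ S) (h : P ≤ᶜ Q) : S * P ≤ᶜ S * Q := fun k => by
  simp only [coeff_mul]
  exact Finset.sum_le_sum fun x _ => mul_le_mul_of_nonneg_left (h _) (by simpa using hS x.1)

theorem mul_right (hS : 0 ≤ᶜ S) (h : P ≤ᶜ Q) : P * S ≤ᶜ Q * S := by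
  simpa [mul_comm] using mul_left hS h

theorem zero_le_mul (h : 0 ≤ᶜ P) (h' : 0 ≤ᶜ Q) : 0 ≤ᶜ P * Q := by
  simpa using mul_left h h'

theorem zero_le_pow (h : 0 ≤ᶜ P) (n : ℕ) : 0 ≤ᶜ P ^ n := by
  induction n with
  | zero => intro k; rw [pow_zero, coeff_one]; split_ifs <;> simp
  | succ n ih => rw [pow_succ]; exact zero_le_mul ih h

theorem zero_le_C {a : ℝ} (ha : 0 ≤ a) : 0 ≤ᶜ C a := fun k => by
  rw [coeff_C]; split_ifs <;> simp [ha]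

theorem zero_le_X : 0 ≤ᶜ (X : ℝ[X]) := fun k => by
  rw [coeff_X]; split_ifs <;> simp

theorem zero_le_X_pow (n : ℕ) : 0 ≤ᶜ (X ^ n : ℝ[X]) := zero_le_pow zero_le_X n

theorem zero_le_natCast (n : ℕ) : 0 ≤ᶜ (n : ℝ[X]) := by
  have := zero_le_C (Nat.cast_nonneg (α := ℝ) n)
  simpa using this

theorem sum {ι : Type*} {s : Finset ι} {f g : ι → ℝ[X]} (h : ∀ i ∈ s, f i ≤ᶜ g i) :
    ∑ i ∈ s, f i ≤ᶜ ∑ i ∈ s, g i := fun k => by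
  simp only [finsetSum_coeff]
  exact Finset.sum_le_sum fun i hi => h i hi k

theorem zero_le_sum {ι : Type*} {s : Finset ι} {f : ι → ℝ[X]} (h : ∀ i ∈ s, 0 ≤ᶜ f i) :
    0 ≤ᶜ ∑ i ∈ s, f i := by
  simpa using sum h

theorem single_le_sum {ι : Type*} {s : Finset ι} {f : ι → ℝ[X]} (h : ∀ i ∈ s, 0 ≤ᶜ f i)
    {i : ι} (hi : i ∈ s) : f i ≤ᶜ ∑ i ∈ s, f i := fun k => by
  simp only [finsetSum_coeff]
  exact Finset.single_le_sum (f := fun i => (f i).coeff k) (fun j hj => by simpa using h j hj k) hi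

theorem C_mul_le_C_mul {a b : ℝ} (hP : 0 ≤ᶜ P) (h : a ≤ b) : C a * P ≤ᶜ C b * P := fun k => by
  simp only [coeff_C_mul]
  exact mul_le_mul_of_nonneg_right h (by simpa using hP k)

theorem of_zero_le_sub (h : 0 ≤ᶜ Q - P) : P ≤ᶜ Q := fun k => by
  simpa using h k

theorem le_add_right (h : P ≤ᶜ Q) (h' : 0 ≤ᶜ S) : P ≤ᶜ Q + S := by
  simpa using h.add h'

end CoeffLE

/-! ### Counting vectors in a discrete cube by their sum. -/

/-- The polynomial `1 + X + ⋯ + X ^ m`. -/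
noncomputable def geomPoly (m : ℕ) : ℝ[X] := ∑ i ∈ Finset.range (m + 1), X ^ i

/-- The number of vectors in `{0, …, m} ^ k` with sum `Y`. -/
noncomputable def comps (m k Y : ℕ) : ℝ := ((geomPoly m) ^ k).coeff Y

theorem zero_le_geomPoly (m : ℕ) : 0 ≤ᶜ geomPoly m :=
  CoeffLE.zero_le_sum fun i _ => CoeffLE.zero_le_X_pow i

theorem comps_nonneg (m k Y : ℕ) : 0 ≤ comps m k Y := by
  simpa [comps] using CoeffLE.zero_le_pow (zero_le_geomPoly m) k Y

theorem one_sub_X_mul_geomPoly (m : ℕ) : (1 - X) * geomPoly m = 1 - X ^ (m + 1) := by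
  rw [geomPoly, mul_comm]
  have := geom_sum_mul (X : ℝ[X]) (m + 1)
  linear_combination -this

theorem one_sub_X_mul_derivative_geomPoly (m : ℕ) :
    (1 - X) * derivative (geomPoly m) = geomPoly m - C ((m : ℝ) + 1) * X ^ m := by
  have := congrArg derivative (one_sub_X_mul_geomPoly m)
  rw [derivative_mul] at this
  simp at this
  simp
  linear_combination this

/-- Coefficients of the differential equation `(1 - X) P' = (k + 1) (P - (m + 1) X^m g^k)` for `P =
g^(k+1)`, `g = geomPoly m`. The last term is the effect of the cap `m`. Without it the counts would
grow by exactly `(Y + k + 1) / (Y + 1)`. -/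
theorem comps_recurrence (m k Y : ℕ) :
    ((Y : ℝ) + 1) * comps m (k + 1) (Y + 1) = ((Y : ℝ) + k + 1) * comps m (k + 1) Y
      - ((k : ℝ) + 1) * ((m : ℝ) + 1) * (if m ≤ Y then comps m k (Y - m) else 0) := by
  have h : (1 - X) * derivative (geomPoly m ^ (k + 1)) =
      C ((k : ℝ) + 1) * geomPoly m ^ (k + 1)
        - C (((k : ℝ) + 1) * ((m : ℝ) + 1)) * (geomPoly m ^ k * X ^ m) := by
    rw [derivative_pow]
    simp only [Nat.cast_add, Nat.cast_one, Nat.add_sub_cancel, C_mul]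
    linear_combination (C ((k : ℝ) + 1) * geomPoly m ^ k) * one_sub_X_mul_derivative_geomPoly m
  have h2 := congrArg (fun P => P.coeff Y) h
  simp only [sub_mul, one_mul, coeff_sub, coeff_C_mul, coeff_mul_X_pow', coeff_derivative] at h2
  have h3 : (X * derivative (geomPoly m ^ (k + 1))).coeff Y = Y * comps m (k + 1) Y := by
    cases Y with
    | zero => simp
    | succ Y => rw [coeff_X_mul, coeff_derivative, comps]; push_cast; ring
  rw [h3] at h2
  simp only [comps] at *
  linear_combination h2

theorem comps_sub (m k Y : ℕ) : comps m (k + 1) (Y + 1) - comps m (k + 1) Y =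
    comps m k (Y + 1) - (if m ≤ Y then comps m k (Y - m) else 0) := by
  have h : (1 - X) * geomPoly m ^ (k + 1) = geomPoly m ^ k - geomPoly m ^ k * X ^ (m + 1) := by
    linear_combination geomPoly m ^ k * one_sub_X_mul_geomPoly m
  have h2 := congrArg (fun P => P.coeff (Y + 1)) h
  simp only [sub_mul, one_mul, coeff_sub, coeff_X_mul, coeff_mul_X_pow'] at h2
  simp only [comps]
  rw [h2]
  simp

theorem X_pow_le_geomPoly {m a : ℕ} (ha : a ≤ m) : X ^ a ≤ᶜ geomPoly m :=
  CoeffLE.single_le_sum (f := fun i => (X ^ i : ℝ[X])) (fun i _ => CoeffLE.zero_le_X_pow i)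
    (by simpa [Nat.lt_succ_iff] using ha)

theorem X_pow_mul_geomPoly_pow_le {m a : ℕ} (ha : a ≤ m) (k : ℕ) :
    X ^ a * geomPoly m ^ k ≤ᶜ geomPoly m ^ (k + 1) := by
  rw [pow_succ']
  exact CoeffLE.mul_right (CoeffLE.zero_le_pow (zero_le_geomPoly m) k) (X_pow_le_geomPoly ha)

theorem comps_le_comps_succ {m a : ℕ} (ha : a ≤ m) (k Y : ℕ) :
    comps m k Y ≤ comps m (k + 1) (Y + a) := by
  have := X_pow_mul_geomPoly_pow_le ha k (Y + a)
  rwa [coeff_X_pow_mul] at this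

theorem comps_zero_right (m k : ℕ) : comps m k 0 = 1 := by
  simp [comps, coeff_zero_eq_eval_zero, geomPoly, eval_finsetSum, Finset.sum_range_succ', eval_pow]

theorem coeff_geomPoly_sq {m a : ℕ} (ha : a ≤ m) : (geomPoly m ^ 2).coeff a = a + 1 := by
  have hc : ∀ i, i ≤ m → (geomPoly m).coeff i = 1 := fun i hi => by
    simp [geomPoly, coeff_X_pow, hi]
  rw [sq, coeff_mul, Finset.sum_congr rfl (g := fun _ => (1 : ℝ))]
  · simp
  · intro x hx
    have := Finset.HasAntidiagonal.mem_antidiagonal.1 hx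
    rw [hc _ (by omega), hc _ (by omega), one_mul]

/-- The counts grow at rate at most `1 + k / Y`. -/
theorem comps_succ_le (m k Y : ℕ) :
    ((Y : ℝ) + 1) * comps m k (Y + 1) ≤ ((Y : ℝ) + k) * comps m k Y := by
  cases k with
  | zero =>
    have : comps m 0 (Y + 1) = 0 := by simp [comps, coeff_one]
    rw [this]
    have := comps_nonneg m 0 Y
    simp
    positivity
  | succ k =>
    rw [comps_recurrence]
    have : 0 ≤ ((k : ℝ) + 1) * ((m : ℝ) + 1) * (if m ≤ Y then comps m k (Y - m) else 0) := by
      have := comps_nonneg m k (Y - m)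
      split_ifs <;> positivity
    push_cast
    linarith

/-- Below `3 k / δ` the counts grow at rate at least `1 + δ / 4`. -/
theorem comps_growth {m k : ℕ} {δ : ℝ} (hδ : 0 < δ) (hk : 20 ≤ k)
    (hm : 20 * ((m : ℝ) + 1) ≤ (1 + δ / 4) ^ m) (Y : ℕ) (hY : δ * (Y + 1) ≤ 3 * k) :
    (1 + δ / 4) * comps m k Y ≤ comps m k (Y + 1) := by
  induction Y using Nat.strong_induction_on with
  | _ Y ih =>
    obtain ⟨k, rfl⟩ : ∃ k', k = k' + 1 := ⟨k - 1, by omega⟩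
    have hc := comps_nonneg m (k + 1) Y
    -- By induction the counts have grown by `(1 + δ/4)^m ≥ 20 (m + 1)` between `Y - m` and `Y`, so
    -- the cap costs at most a twentieth of the main term.
    have hbound : ((m : ℝ) + 1) * (if m ≤ Y then comps m k (Y - m) else 0)
        ≤ comps m (k + 1) Y / 20 := by
      split_ifs with hmY
      · have hstep : ∀ j, j ≤ m → (1 + δ / 4) ^ j * comps m (k + 1) (Y - m) ≤
            comps m (k + 1) (Y - m + j) := by
          intro j
          induction j with
          | zero => simp
          | succ j ihj =>
            intro hj
            have h1 := ihj (by omega)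
            have h2 := ih (Y - m + j) (by omega) (by
              refine le_trans ?_ hY
              have : ((Y - m + j : ℕ) : ℝ) ≤ Y := by exact_mod_cast (by omega)
              gcongr)
            calc (1 + δ / 4) ^ (j + 1) * comps m (k + 1) (Y - m)
                = (1 + δ / 4) * ((1 + δ / 4) ^ j * comps m (k + 1) (Y - m)) := by ring
              _ ≤ (1 + δ / 4) * comps m (k + 1) (Y - m + j) := by gcongr
              _ ≤ _ := h2
        have h1 := hstep m le_rfl
        rw [Nat.sub_add_cancel hmY] at h1
        have h2 := comps_le_comps_succ (Nat.zero_le m) k (Y - m)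
        rw [add_zero] at h2
        have h3 := comps_nonneg m (k + 1) (Y - m)
        have h4 : 20 * ((m : ℝ) + 1) * comps m k (Y - m) ≤ comps m (k + 1) Y :=
          calc 20 * ((m : ℝ) + 1) * comps m k (Y - m)
              ≤ 20 * ((m : ℝ) + 1) * comps m (k + 1) (Y - m) := by gcongr
            _ ≤ (1 + δ / 4) ^ m * comps m (k + 1) (Y - m) := by gcongr
            _ ≤ _ := h1
        linarith
      · simpa using by positivity
    have hrec := comps_recurrence m k Y
    have hk' : (20 : ℝ) ≤ (k : ℝ) + 1 := by exact_mod_cast hk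
    push_cast at hY
    have hYpos : (0 : ℝ) < (Y : ℝ) + 1 := by positivity
    -- With `q = k + 1 ≥ 20` parts, the required increment is `1 + δ (Y + 1) / 4 ≤ 1 + 3q/4`, and
    -- the recurrence supplies `q - q/20`.
    have key : ((Y : ℝ) + 1) * ((1 + δ / 4) * comps m (k + 1) Y) ≤
        ((Y : ℝ) + 1) * comps m (k + 1) (Y + 1) := by
      rw [hrec]
      have h5 : ((k : ℝ) + 1) * (((m : ℝ) + 1) * (if m ≤ Y then comps m k (Y - m) else 0))
          ≤ ((k : ℝ) + 1) * (comps m (k + 1) Y / 20) := by gcongr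
      have h6 : 0 ≤ (3 * ((k : ℝ) + 1) - δ * (Y + 1)) * comps m (k + 1) Y :=
        mul_nonneg (by linarith) hc
      have h7 : 0 ≤ ((k : ℝ) + 1 - 20) * comps m (k + 1) Y := mul_nonneg (by linarith) hc
      linarith
    exact le_of_mul_le_mul_left key hYpos

theorem comps_growth_pow {m k : ℕ} {δ : ℝ} (hδ : 0 < δ) (hk : 20 ≤ k)
    (hm : 20 * ((m : ℝ) + 1) ≤ (1 + δ / 4) ^ m) (Y U : ℕ) (hY : δ * (Y + U) ≤ 3 * k) :
    (1 + δ / 4) ^ U * comps m k Y ≤ comps m k (Y + U) := by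
  induction U with
  | zero => simp
  | succ U ih =>
    have h0 : δ * (Y + U) ≤ 3 * k := by
      refine le_trans ?_ hY
      push_cast; nlinarith
    have h1 := comps_growth hδ hk hm (Y + U) (by push_cast at hY ⊢; linarith)
    calc (1 + δ / 4) ^ (U + 1) * comps m k Y
        = (1 + δ / 4) * ((1 + δ / 4) ^ U * comps m k Y) := by ring
      _ ≤ (1 + δ / 4) * comps m k (Y + U) := by gcongr; exact ih h0
      _ ≤ _ := h1

end ShuffledDP

/-! ### Steep and flat ranges of the counts. -/

namespace ShuffledDP

open Polynomial

/-- For `δ Y ≤ 2i`, the counts gain a factor `(1 + δ/4)^U ≥ 1 / (δ κ)` over the next `U` sums, and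
an extra part equal to `m - U` reaches total `Y + m`. For larger `Y`, the one-step ratio is at most
`1 + δ/2`, which the first term covers. -/
theorem comps_le_of_steep_or {m i k₀ U Y : ℕ} {δ r κ : ℝ} (hδ : 0 < δ) (hκ : 0 ≤ κ)
    (hr : 1 + δ / 2 ≤ (1 + δ) * r) (hk₀ : 20 ≤ k₀) (hi : k₀ ≤ i)
    (hm : 20 * ((m : ℝ) + 1) ≤ (1 + δ / 4) ^ m) (hUm : U ≤ m) (hUk : δ * U ≤ k₀)
    (hU : 1 ≤ δ * κ * (1 + δ / 4) ^ U) :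
    comps m i Y ≤ (1 + δ) * r * (if 1 ≤ Y then comps m i (Y - 1) else 0)
      + δ * κ * comps m (i + 1) (Y + m) := by
  have hi' : (k₀ : ℝ) ≤ i := by exact_mod_cast hi
  have hr0 : 0 ≤ (1 + δ) * r := by linarith
  have hc := comps_nonneg m i Y
  have hc' := comps_nonneg m i (Y - 1)
  by_cases hY : δ * Y ≤ 2 * i
  · have h1 := comps_growth_pow hδ (hk₀.trans hi) hm Y U (by linarith)
    have h2 := comps_le_comps_succ (m := m) (a := m - U) (by omega) i (Y + U)
    rw [show Y + U + (m - U) = Y + m by omega] at h2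
    have h3 : 0 ≤ (1 + δ) * r * (if 1 ≤ Y then comps m i (Y - 1) else 0) :=
      mul_nonneg hr0 (by split_ifs <;> simp [hc'])
    calc comps m i Y ≤ δ * κ * (1 + δ / 4) ^ U * comps m i Y := le_mul_of_one_le_left hc hU
      _ = δ * κ * ((1 + δ / 4) ^ U * comps m i Y) := by ring
      _ ≤ δ * κ * comps m (i + 1) (Y + m) := by gcongr; exact h1.trans h2
      _ ≤ _ := by linarith
  · push Not at hY
    have h2 : 0 ≤ δ * κ * comps m (i + 1) (Y + m) :=
      mul_nonneg (by positivity) (comps_nonneg _ _ _)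
    obtain ⟨Z, rfl⟩ : ∃ Z, Y = Z + 1 := by
      refine ⟨Y - 1, ?_⟩
      have : Y ≠ 0 := by
        rintro rfl
        have : (0 : ℝ) ≤ i := by positivity
        simp at hY; linarith
      omega
    simp only [Nat.le_add_left, if_true, Nat.add_sub_cancel] at hc' ⊢
    have h3 := comps_succ_le m i Z
    have hZ : (0 : ℝ) < (Z : ℝ) + 1 := by positivity
    have h4 : ((Z : ℝ) + i) * comps m i Z ≤ ((Z : ℝ) + 1) * ((1 + δ / 2) * comps m i Z) := by
      rw [← mul_assoc]
      push_cast at hY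
      gcongr
      linarith
    have h5 := le_of_mul_le_mul_left (h3.trans h4) hZ
    have h6 : (1 + δ / 2) * comps m i Z ≤ (1 + δ) * r * comps m i Z := by gcongr
    linarith

/-- Growth at rate `1 + δ/4` makes the increment from `Y - 1` to `Y` a fraction of order `δ` of the
count, and by `comps_sub` that increment is at most the count with one part fewer. -/
theorem comps_succ_le_mul_comps {m k Y : ℕ} {δ : ℝ} (hδ : 0 < δ) (hδ1 : δ ≤ 1) (hk : 20 ≤ k + 1)
    (hm : 20 * ((m : ℝ) + 1) ≤ (1 + δ / 4) ^ m) (hY : δ * Y ≤ 3 * (k + 1)) :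
    comps m (k + 1) Y ≤ 8 / δ * comps m k Y := by
  cases Y with
  | zero =>
    rw [comps_zero_right, comps_zero_right, mul_one, le_div_iff₀ hδ]
    linarith
  | succ Z =>
    push_cast at hY
    have h1 := comps_growth hδ hk hm Z (by push_cast; linarith)
    have h2 := comps_sub m k Z
    have h3 : 0 ≤ (if m ≤ Z then comps m k (Z - m) else 0) := by
      split_ifs
      · exact comps_nonneg _ _ _
      · exact le_rfl
    have h4 : comps m (k + 1) (Z + 1) ≤ comps m (k + 1) Z + comps m k (Z + 1) := by linarith
    have h5 : 0 ≤ (1 - δ) * comps m k (Z + 1) :=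
      mul_nonneg (by linarith) (comps_nonneg _ _ _)
    rw [div_mul_eq_mul_div, le_div_iff₀ hδ]
    have h6 : (1 + δ / 4) * comps m (k + 1) (Z + 1) ≤ comps m (k + 1) (Z + 1) +
        (1 + δ / 4) * comps m k (Z + 1) := by
      have : (1 + δ / 4) * comps m (k + 1) (Z + 1) ≤
        (1 + δ / 4) * (comps m (k + 1) Z + comps m k (Z + 1)) := by gcongr
      linarith
    have h7 := comps_nonneg m k (Z + 1)
    linarith

theorem comps_add_le_mul_comps {m k Y h e : ℕ} {δ : ℝ} (hδ : 0 < δ) (hδ1 : δ ≤ 1) (hk : 20 ≤ k)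
    (hm : 20 * ((m : ℝ) + 1) ≤ (1 + δ / 4) ^ m) (hY : δ * (Y + e) ≤ 3 * k) :
    comps m (k + h) Y ≤ (8 / δ) ^ h * comps m k (Y + e) := by
  induction h with
  | zero =>
    have h1 := comps_growth_pow hδ hk hm Y e hY
    have h2 : 1 ≤ (1 + δ / 4) ^ e := one_le_pow₀ (by linarith)
    simp only [add_zero, pow_zero, one_mul]
    exact (le_mul_of_one_le_left (comps_nonneg _ _ _) h2).trans h1
  | succ h ih =>
    have h1 : δ * Y ≤ 3 * ((k + h : ℕ) + 1) := by
      push_cast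
      have : 0 ≤ δ * e := by positivity
      have : (0 : ℝ) ≤ h := by positivity
      linarith
    calc comps m (k + h + 1) Y ≤ 8 / δ * comps m (k + h) Y :=
          comps_succ_le_mul_comps hδ hδ1 (by omega) hm h1
      _ ≤ 8 / δ * ((8 / δ) ^ h * comps m k (Y + e)) := by gcongr
      _ = _ := by ring

/-! ### Generating polynomials of the noise, and the case of many lower-noise users. -/

/-- The generating polynomial `∑ v ≤ m, r ^ v X ^ (m - v)`. -/
noncomputable def lapLeft (m : ℕ) (r : ℝ) : ℝ[X] := C (r ^ m) * (geomPoly m).comp (C r⁻¹ * X)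

/-- The generating polynomial `∑ v ≤ m, r ^ v X ^ v`. -/
noncomputable def lapRight (m : ℕ) (r : ℝ) : ℝ[X] := (geomPoly m).comp (C r * X)

/-- The generating polynomial of the unnormalized truncated discrete Laplace distribution. -/
noncomputable def noisePoly (m : ℕ) (r κ : ℝ) : ℝ[X] :=
  C κ * (lapLeft m r + X ^ (m + 1) * lapRight m r)

theorem coeff_lapLeft_pow (m : ℕ) (r : ℝ) (i Y : ℕ) :
    ((lapLeft m r) ^ i).coeff Y = (r ^ m) ^ i * (comps m i Y * r⁻¹ ^ Y) := by
  rw [lapLeft, mul_pow, ← C_pow, coeff_C_mul, ← pow_comp, comp_C_mul_X_coeff, comps]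

theorem coeff_lapRight_pow (m : ℕ) (r : ℝ) (i Y : ℕ) :
    ((lapRight m r) ^ i).coeff Y = comps m i Y * r ^ Y := by
  rw [lapRight, ← pow_comp, comp_C_mul_X_coeff, comps]

variable {m : ℕ} {r κ α δ : ℝ}

theorem zero_le_lapLeft (hr : 0 ≤ r) : 0 ≤ᶜ lapLeft m r := fun k => by
  rw [← pow_one (lapLeft m r), coeff_lapLeft_pow]
  have := comps_nonneg m 1 k
  simp; positivity

theorem zero_le_lapRight (hr : 0 ≤ r) : 0 ≤ᶜ lapRight m r := fun k => by
  rw [← pow_one (lapRight m r), coeff_lapRight_pow]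
  have := comps_nonneg m 1 k
  simp; positivity

theorem zero_le_noisePoly (hr : 0 ≤ r) (hκ : 0 ≤ κ) : 0 ≤ᶜ noisePoly m r κ :=
  CoeffLE.zero_le_mul (CoeffLE.zero_le_C hκ) (CoeffLE.zero_le_add (zero_le_lapLeft hr)
    (CoeffLE.zero_le_mul (CoeffLE.zero_le_X_pow _) (zero_le_lapRight hr)))

theorem C_mul_lapLeft_le_noisePoly (hr : 0 ≤ r) (hκ : 0 ≤ κ) :
    C κ * lapLeft m r ≤ᶜ noisePoly m r κ :=
  CoeffLE.mul_left (CoeffLE.zero_le_C hκ) (CoeffLE.le_add_right (CoeffLE.refl _)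
    (CoeffLE.zero_le_mul (CoeffLE.zero_le_X_pow _) (zero_le_lapRight hr)))

/-- Moving one non-noisy user from input `0` to input `1` changes the count distribution of the
others, given by `G`, in a controlled way, using noise of that user. -/
def Good (m : ℕ) (r κ α δ δ' : ℝ) (G : ℝ[X]) : Prop :=
  C α * X ^ m * G ≤ᶜ C (1 + δ) * (C α * X ^ (m + 1) * G) + C δ' * (noisePoly m r κ * G)

theorem Good.mul {δ' : ℝ} {G H : ℝ[X]} (h : Good m r κ α δ δ' G) (hH : 0 ≤ᶜ H) :
    Good m r κ α δ δ' (H * G) := by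
  have := CoeffLE.mul_left hH h
  unfold Good
  convert this using 1 <;> ring

/-- After the powers of `r` are factored out, the coefficients are the counts compared in
`comps_le_of_steep_or`. The term with `i + 1` parts is the moved user sending lower noise. -/
theorem good_lapLeft_pow {i k₀ U : ℕ} (hδ : 0 < δ) (hκ : 0 ≤ κ) (hr0 : 0 < r) (hα : 0 ≤ α)
    (hα1 : α ≤ 1) (hr : 1 + δ / 2 ≤ (1 + δ) * r) (hk₀ : 20 ≤ k₀) (hi : k₀ ≤ i)
    (hm : 20 * ((m : ℝ) + 1) ≤ (1 + δ / 4) ^ m) (hUm : U ≤ m) (hUk : δ * U ≤ k₀)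
    (hU : 1 ≤ δ * κ * (1 + δ / 4) ^ U) :
    Good m r κ α δ δ (lapLeft m r ^ i) := by
  have hL := zero_le_lapLeft (m := m) hr0.le
  have h0 : C δ * (C κ * lapLeft m r ^ (i + 1)) ≤ᶜ C δ * (noisePoly m r κ * lapLeft m r ^ i) := by
    refine CoeffLE.mul_left (CoeffLE.zero_le_C hδ.le) ?_
    rw [pow_succ', ← mul_assoc]
    exact CoeffLE.mul_right (CoeffLE.zero_le_pow hL i) (C_mul_lapLeft_le_noisePoly hr0.le hκ)
  refine CoeffLE.trans ?_ ((CoeffLE.refl _).add h0)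
  intro K
  simp only [mul_assoc, coeff_C_mul, coeff_X_pow_mul', coeff_add, coeff_lapLeft_pow]
  by_cases hK : m ≤ K
  · obtain ⟨Y, rfl⟩ := Nat.exists_eq_add_of_le' hK
    have key := comps_le_of_steep_or (Y := Y) hδ hκ hr hk₀ hi hm hUm hUk hU
    have hc2 := comps_nonneg m (i + 1) (Y + m)
    -- The exponent of `r` is the total shortfall below `m` per noisy user, which is the same for
    -- `i` users with sum `Y` and for `i + 1` users with sum `Y + m`.
    have hrm : (r ^ m) ^ (i + 1) * r⁻¹ ^ (Y + m) = (r ^ m) ^ i * r⁻¹ ^ Y := by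
      rw [pow_succ, pow_add]
      have : r ^ m * r⁻¹ ^ m = 1 := by rw [← mul_pow, mul_inv_cancel₀ hr0.ne', one_pow]
      linear_combination (r ^ m) ^ i * r⁻¹ ^ Y * this
    have e1 : (r ^ m) ^ (i + 1) * (comps m (i + 1) (Y + m) * r⁻¹ ^ (Y + m)) =
        (r ^ m) ^ i * r⁻¹ ^ Y * comps m (i + 1) (Y + m) := by
      rw [← hrm]; ring
    rw [e1, if_pos hK, Nat.add_sub_cancel]
    have hw : 0 ≤ (r ^ m) ^ i * r⁻¹ ^ Y := by positivity
    have h2 : δ * κ * comps m (i + 1) (Y + m) * α ≤ δ * κ * comps m (i + 1) (Y + m) :=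
      mul_le_of_le_one_right (by positivity) hα1
    have h3 : (if m + 1 ≤ Y + m then (r ^ m) ^ i *
          (comps m i (Y + m - (m + 1)) * r⁻¹ ^ (Y + m - (m + 1))) else 0) =
        (r ^ m) ^ i * r⁻¹ ^ Y * (r * (if 1 ≤ Y then comps m i (Y - 1) else 0)) := by
      by_cases hY : 1 ≤ Y
      · obtain ⟨Z, rfl⟩ := Nat.exists_eq_add_of_le' hY
        rw [if_pos (by omega), if_pos hY, show Z + 1 + m - (m + 1) = Z by omega,
          show Z + 1 - 1 = Z by omega, pow_succ]
        field_simp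
      · rw [if_neg (by omega), if_neg hY]; simp
    rw [h3]
    have h4 := mul_le_mul_of_nonneg_left key hα
    have h5 : α * comps m i Y ≤ (1 + δ) * (α * (r * (if 1 ≤ Y then comps m i (Y - 1) else 0))) +
        δ * (κ * comps m (i + 1) (Y + m)) := by linarith
    have h6 := mul_le_mul_of_nonneg_left h5 hw
    linarith
  · rw [if_neg hK, if_neg (by omega)]
    have := comps_nonneg m (i + 1) K
    simp; positivity

/-- One noisy user is lowered by one, which multiplies the weight by `r`. The two exceptions are
kept exactly: value `m` never arises by lowering (subtracted term), and value `0` cannot be lowered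
(last term). -/
theorem lapLeft_pow_succ (hr : r ≠ 0) (i : ℕ) : lapLeft m r ^ (i + 1) =
    C r⁻¹ * X * (lapLeft m r ^ (i + 1) - X ^ m * lapLeft m r ^ i)
      + C (r ^ m) * lapLeft m r ^ i := by
  have h := congrArg (fun P => P.comp (C r⁻¹ * X)) (one_sub_X_mul_geomPoly m)
  simp only [mul_comp, sub_comp, one_comp, X_comp, pow_comp, mul_pow, ← C_pow] at h
  have h1 : C (r ^ m) * C (r⁻¹ ^ m) = (1 : ℝ[X]) := by
    rw [← C_mul, ← mul_pow, mul_inv_cancel₀ hr, one_pow, C_1]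
  have h2 : C (r⁻¹ ^ (m + 1)) = C (r⁻¹ ^ m) * C r⁻¹ := by rw [pow_succ, C_mul]
  rw [h2] at h
  have h3 : lapLeft m r = C r⁻¹ * X * (lapLeft m r - X ^ m) + C (r ^ m) := by
    rw [lapLeft]
    linear_combination C (r ^ m) * h - C r⁻¹ * X * X ^ m * h1
  rw [pow_succ]
  linear_combination lapLeft m r ^ i * h3

theorem lapLeft_pow_succ_le (hr : 0 < r) (i : ℕ) : lapLeft m r ^ (i + 1) ≤ᶜ
    C r⁻¹ * X * lapLeft m r ^ (i + 1) + C (r ^ m) * lapLeft m r ^ i := by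
  refine CoeffLE.of_zero_le_sub ?_
  have h := lapLeft_pow_succ (m := m) hr.ne' i
  have : C r⁻¹ * X * lapLeft m r ^ (i + 1) + C (r ^ m) * lapLeft m r ^ i - lapLeft m r ^ (i + 1) =
      C r⁻¹ * X * (X ^ m * lapLeft m r ^ i) := by linear_combination -h
  rw [this]
  exact CoeffLE.zero_le_mul (CoeffLE.zero_le_mul (CoeffLE.zero_le_C (by positivity))
    CoeffLE.zero_le_X) (CoeffLE.zero_le_mul (CoeffLE.zero_le_X_pow _)
      (CoeffLE.zero_le_pow (zero_le_lapLeft hr.le) _))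

/-- Two lower-noise users reach the sum `m + b - 1` in at least `m` ways, each of weight at least
`r^(m+1)`. This factor `m` is what beats a user stuck at value `0`. -/
theorem le_lapLeft_sq (hr : 0 < r) (hr1 : r ≤ 1) {b : ℕ} (hb : b ≤ 1) (hm : 1 ≤ m) :
    C ((m : ℝ) * r ^ m) * X ^ m ≤ᶜ C r⁻¹ * X ^ (1 - b) * lapLeft m r ^ 2 := by
  have key : ∀ a ≤ m, C (((a : ℝ) + 1) * ((r ^ m) ^ 2 * r⁻¹ ^ a)) * X ^ a ≤ᶜ lapLeft m r ^ 2 := by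
    intro a ha K
    rw [coeff_lapLeft_pow, coeff_C_mul, coeff_X_pow]
    split_ifs with h
    · rw [h, comps, coeff_geomPoly_sq ha]
      apply le_of_eq; ring
    · have := comps_nonneg m 2 K
      rw [mul_zero]; positivity
  have hrm : r ^ m * r⁻¹ ^ m = 1 := by rw [← mul_pow, mul_inv_cancel₀ hr.ne', one_pow]
  interval_cases b
  · obtain ⟨a, rfl⟩ := Nat.exists_eq_add_of_le' hm
    have h1 := CoeffLE.mul_left (S := C r⁻¹ * X) (CoeffLE.zero_le_mul
      (CoeffLE.zero_le_C (by positivity)) CoeffLE.zero_le_X) (key a (by omega))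
    have e : C r⁻¹ * X * (C (((a : ℝ) + 1) * ((r ^ (a + 1)) ^ 2 * r⁻¹ ^ a)) * X ^ a) =
        C (((a + 1 : ℕ) : ℝ) * r ^ (a + 1)) * X ^ (a + 1) := by
      have : (((a + 1 : ℕ) : ℝ) * r ^ (a + 1)) =
          r⁻¹ * (((a : ℝ) + 1) * ((r ^ (a + 1)) ^ 2 * r⁻¹ ^ a)) := by
        push_cast
        rw [pow_succ r⁻¹] at hrm
        linear_combination -((a : ℝ) + 1) * r ^ (a + 1) * hrm
      rw [this, C_mul (a := r⁻¹)]; ring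
    rw [e] at h1
    simpa using h1
  · have h1 := CoeffLE.mul_left (S := C r⁻¹) (CoeffLE.zero_le_C (by positivity)) (key m le_rfl)
    have e : ((m : ℝ) + 1) * ((r ^ m) ^ 2 * r⁻¹ ^ m) = ((m : ℝ) + 1) * r ^ m := by
      linear_combination ((m : ℝ) + 1) * r ^ m * hrm
    rw [e, ← mul_assoc, ← C_mul] at h1
    simp only [Nat.sub_self, pow_zero, mul_one]
    refine CoeffLE.trans (CoeffLE.C_mul_le_C_mul (CoeffLE.zero_le_X_pow _) ?_) h1
    have hri : 1 ≤ r⁻¹ := (one_le_inv₀ hr).2 hr1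
    calc (m : ℝ) * r ^ m ≤ ((m : ℝ) + 1) * r ^ m := by gcongr; linarith
      _ ≤ r⁻¹ * (((m : ℝ) + 1) * r ^ m) := le_mul_of_one_le_left (by positivity) hri

end ShuffledDP

/-! ### Mixtures of non-noisy and lower-noise users. -/

namespace ShuffledDP

open Polynomial

variable {m : ℕ} {r κ α δ : ℝ}

/-- The part of `(α X ^ (m + b) + κ * lapLeft) ^ N` with `i` noisy users. -/
noncomputable def binomTerm (m : ℕ) (r κ α : ℝ) (b N i : ℕ) : ℝ[X] :=
  C (N.choose i : ℝ) * (C α * X ^ (m + b)) ^ (N - i) * (C κ * lapLeft m r) ^ i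

theorem zero_le_binomTerm (hr : 0 ≤ r) (hκ : 0 ≤ κ) (hα : 0 ≤ α) (b N i : ℕ) :
    0 ≤ᶜ binomTerm m r κ α b N i :=
  CoeffLE.zero_le_mul (CoeffLE.zero_le_mul (CoeffLE.zero_le_C (by positivity))
    (CoeffLE.zero_le_pow (CoeffLE.zero_le_mul (CoeffLE.zero_le_C hα) (CoeffLE.zero_le_X_pow _)) _))
    (CoeffLE.zero_le_pow (CoeffLE.zero_le_mul (CoeffLE.zero_le_C hκ) (zero_le_lapLeft hr)) _)

theorem sum_binomTerm (b N : ℕ) : ∑ i ∈ Finset.range (N + 1), binomTerm m r κ α b N i =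
    (C α * X ^ (m + b) + C κ * lapLeft m r) ^ N := by
  rw [add_comm (C α * X ^ (m + b)), add_pow]
  refine Finset.sum_congr rfl fun i _ => ?_
  rw [binomTerm, C_eq_natCast]
  ring

/-- A noisy user at `0` and a non-noisy user at `m + b` are replaced by two noisy users with sum `m
+ b - 1`, while the moved user goes from `m` to `m + 1`. The gain is about `m κ`, times the ratio
`(N - (j + 1)) / (j + 2)` of consecutive binomial coefficients. -/
theorem binomTerm_move {b N j : ℕ} (hb : b ≤ 1) (hm : 1 ≤ m) (hr : 0 < r) (hr1 : r ≤ 1)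
    (hκ : 0 ≤ κ) (hα : 0 ≤ α) (hα1 : α ≤ 1) (hN : j + 2 ≤ N)
    (h : ((j : ℝ) + 2) ≤ δ * r * m * κ * (N - (j + 1))) :
    C ((N.choose (j + 1) : ℝ) * κ ^ (j + 1) * α * r ^ m) * (C α * X ^ (m + b)) ^ (N - (j + 1)) *
      X ^ m * lapLeft m r ^ j ≤ᶜ
      C δ * (C α * X ^ (m + 1) * binomTerm m r κ α b N (j + 2)) := by
  obtain ⟨M, rfl⟩ := Nat.exists_eq_add_of_le' hN
  have hm0 : (0 : ℝ) < m := by exact_mod_cast hm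
  set ch1 : ℝ := ((M + (j + 2)).choose (j + 1) : ℝ) with hch1
  set ch2 : ℝ := ((M + (j + 2)).choose (j + 2) : ℝ) with hch2
  have hch : ch2 * (j + 2) = ch1 * (M + 1) := by
    have := Nat.choose_succ_right_eq (M + (j + 2)) (j + 1)
    rw [show M + (j + 2) - (j + 1) = M + 1 by omega] at this
    rw [hch1, hch2]
    exact_mod_cast this
  have hch1' : 0 ≤ ch1 := by positivity
  have hch2' : 0 ≤ ch2 := by positivity
  push_cast at h
  have hle : ch1 * κ ^ (j + 1) * α / m * r⁻¹ ≤ δ * ch2 * κ ^ (j + 2) := by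
    have h1 : ch1 ≤ δ * r * m * κ * ch2 := by
      have hM : (0 : ℝ) < (M : ℝ) + 1 := by positivity
      have h2 : ch2 * ((j : ℝ) + 2) ≤ ch2 * (δ * r * m * κ * (M + (j + 2) - (j + 1))) := by gcongr
      rw [hch] at h2
      refine le_of_mul_le_mul_right ?_ hM
      linarith
    rw [div_mul_eq_mul_div, div_le_iff₀ hm0, mul_inv_le_iff₀ hr]
    calc ch1 * κ ^ (j + 1) * α ≤ ch1 * κ ^ (j + 1) := mul_le_of_le_one_right (by positivity) hα1
      _ ≤ (δ * r * m * κ * ch2) * κ ^ (j + 1) := by gcongr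
      _ = _ := by ring
  have hA : 0 ≤ᶜ (C α * X ^ (m + b) : ℝ[X]) :=
    CoeffLE.zero_le_mul (CoeffLE.zero_le_C hα) (CoeffLE.zero_le_X_pow _)
  have hL := zero_le_lapLeft (m := m) hr.le
  have h1 := CoeffLE.mul_left (S := C (ch1 * κ ^ (j + 1) * α / m) *
    (C α * X ^ (m + b)) ^ (M + 1) * lapLeft m r ^ j)
    (CoeffLE.zero_le_mul (CoeffLE.zero_le_mul (CoeffLE.zero_le_C (by positivity))
      (CoeffLE.zero_le_pow hA _)) (CoeffLE.zero_le_pow hL _)) (le_lapLeft_sq hr hr1 hb hm)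
  have e1 : C (ch1 * κ ^ (j + 1) * α * r ^ m) * (C α * X ^ (m + b)) ^ (M + (j + 2) - (j + 1)) *
      X ^ m * lapLeft m r ^ j = C (ch1 * κ ^ (j + 1) * α / m) *
      (C α * X ^ (m + b)) ^ (M + 1) * lapLeft m r ^ j * (C ((m : ℝ) * r ^ m) * X ^ m) := by
    rw [show M + (j + 2) - (j + 1) = M + 1 by omega]
    have : ch1 * κ ^ (j + 1) * α * r ^ m =
      (ch1 * κ ^ (j + 1) * α / m) * ((m : ℝ) * r ^ m) := by field_simp
    rw [this, C_mul (a := ch1 * κ ^ (j + 1) * α / m)]; ring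
  have hX : X ^ b * X ^ (1 - b) = (X : ℝ[X]) := by
    rw [← pow_add, Nat.add_sub_cancel' hb, pow_one]
  have hG : 0 ≤ᶜ C α * X ^ (m + 1) * (C α * X ^ (m + b)) ^ M * lapLeft m r ^ (j + 2) :=
    CoeffLE.zero_le_mul (CoeffLE.zero_le_mul (CoeffLE.zero_le_mul (CoeffLE.zero_le_C hα)
      (CoeffLE.zero_le_X_pow _)) (CoeffLE.zero_le_pow hA _)) (CoeffLE.zero_le_pow hL _)
  rw [e1]
  refine h1.trans ?_
  convert CoeffLE.C_mul_le_C_mul hG hle using 1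
  · rw [C_mul (b := r⁻¹)]
    rw [pow_succ (C α * X ^ (m + b)), pow_add X m b, pow_add X m 1, pow_one]
    linear_combination (C (ch1 * κ ^ (j + 1) * α / ↑m) * C r⁻¹ * (C α * (X ^ m * X ^ b)) ^ M *
      lapLeft m r ^ (j + 2) * C α * X ^ m) * hX
  · rw [binomTerm, show M + (j + 2) - (j + 2) = M by omega, ← hch2, mul_pow (C κ), ← C_pow,
      C_mul, C_mul]
    ring

/-- The unit gained by the moved user is taken from one noisy user at cost `r⁻¹`. If that user is at
`0`, `binomTerm_move` pays. -/
theorem binomTerm_le {b N j : ℕ} (hb : b ≤ 1) (hm : 1 ≤ m) (hr : 0 < r) (hr1 : r ≤ 1)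
    (hκ : 0 ≤ κ) (hα : 0 ≤ α) (hα1 : α ≤ 1) (hN : j + 2 ≤ N)
    (h : ((j : ℝ) + 2) ≤ δ * r * m * κ * (N - (j + 1))) :
    C α * X ^ m * binomTerm m r κ α b N (j + 1) ≤ᶜ
      C r⁻¹ * (C α * X ^ (m + 1) * binomTerm m r κ α b N (j + 1)) +
      C δ * (C α * X ^ (m + 1) * binomTerm m r κ α b N (j + 2)) := by
  have h1 := binomTerm_move hb hm hr hr1 hκ hα hα1 hN h
  have hA : 0 ≤ᶜ (C α * X ^ (m + b) : ℝ[X]) :=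
    CoeffLE.zero_le_mul (CoeffLE.zero_le_C hα) (CoeffLE.zero_le_X_pow _)
  have h2 := CoeffLE.mul_left (S := C ((N.choose (j + 1) : ℝ) * κ ^ (j + 1) * α) *
    (C α * X ^ (m + b)) ^ (N - (j + 1)) * X ^ m) (CoeffLE.zero_le_mul (CoeffLE.zero_le_mul
      (CoeffLE.zero_le_C (by positivity)) (CoeffLE.zero_le_pow hA _)) (CoeffLE.zero_le_X_pow _))
    (lapLeft_pow_succ_le (m := m) hr j)
  refine CoeffLE.trans ?_ ((CoeffLE.refl _).add h1)
  convert h2 using 1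
  · simp only [binomTerm, C_mul, C_pow, mul_pow]; ring
  · simp only [binomTerm, C_mul, C_pow, mul_pow]; ring

/-- Without noisy users there is nothing to lower. For `b = 1` the loss is covered by the subtracted
term of `lapLeft_pow_succ` with one noisy user, which has the same degree and weight `N κ r⁻¹`
against `α`. -/
theorem binomTerm_zero_add_one_le {N : ℕ} (hm : 1 ≤ m) (hr : 0 < r) (hr1 : r ≤ 1)
    (hκ : 0 ≤ κ) (hα : 0 ≤ α) (hα1 : α ≤ 1) (hN : 2 ≤ N)
    (h : 2 ≤ δ * r * m * κ * (N - 1)) (hNκ : 1 ≤ N * κ) :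
    C α * X ^ m * (binomTerm m r κ α 1 N 0 + binomTerm m r κ α 1 N 1) ≤ᶜ
      C r⁻¹ * (C α * X ^ (m + 1) * binomTerm m r κ α 1 N 1) +
      C δ * (C α * X ^ (m + 1) * binomTerm m r κ α 1 N 2) := by
  have h1 := binomTerm_move (j := 0) le_rfl hm hr hr1 hκ hα hα1 hN (by simpa using h)
  refine CoeffLE.trans ?_ ((CoeffLE.refl _).add h1)
  have h2 := lapLeft_pow_succ (m := m) hr.ne' 0
  obtain ⟨M, rfl⟩ := Nat.exists_eq_add_of_le' hN
  have hri : 1 ≤ r⁻¹ := (one_le_inv₀ hr).2 hr1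
  have h3 : α ≤ r⁻¹ * (((M + 2 : ℕ) : ℝ) * κ) := by nlinarith
  have hA : 0 ≤ᶜ (C α * X ^ (m + 1) : ℝ[X]) :=
    CoeffLE.zero_le_mul (CoeffLE.zero_le_C hα) (CoeffLE.zero_le_X_pow _)
  have h4 := CoeffLE.C_mul_le_C_mul (P := X ^ m * (C α * X ^ (m + 1)) ^ (M + 2))
    (CoeffLE.zero_le_mul (CoeffLE.zero_le_X_pow _) (CoeffLE.zero_le_pow hA _)) h3
  refine CoeffLE.of_zero_le_sub ?_
  have h5 : 0 ≤ᶜ C (r⁻¹ * (((M + 2 : ℕ) : ℝ) * κ)) * (X ^ m * (C α * X ^ (m + 1)) ^ (M + 2)) -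
    C α * (X ^ m * (C α * X ^ (m + 1)) ^ (M + 2)) := fun k => by simpa using h4 k
  convert h5 using 1
  simp only [binomTerm, Nat.choose_zero_right, Nat.choose_one_right, Nat.sub_zero, pow_zero,
    zero_add, pow_one, mul_one, Nat.cast_one, C_1, one_mul,
    show M + 2 - 1 = M + 1 by omega] at h2 ⊢
  simp only [C_mul]
  linear_combination (-(C α * X ^ m * C (((M + 2 : ℕ) : ℝ)) * (C α * X ^ (m + 1)) ^ (M + 1) * C κ))
    * h2

/-- For `b = 0`, one of the `N` users takes noise `m - 1`. The others stay at `m`, which now has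
weight `α + κ ≥ α (1 + κ)` because noise can also equal `m`. -/
theorem binomTerm_zero_le {N : ℕ} (hm : 1 ≤ m) (hr : 0 < r)
    (hκ : 0 ≤ κ) (hα : 0 ≤ α) (hα1 : α ≤ 1) (hδ : 0 ≤ δ)
    (hN : 1 ≤ δ * r * N * κ * (1 + κ) ^ (N - 1)) :
    C α * X ^ m * binomTerm m r κ α 0 N 0 ≤ᶜ
      C δ * (C α * X ^ (m + 1) * (C α * X ^ (m + 0) + C κ * lapLeft m r) ^ N) := by
  obtain ⟨a, rfl⟩ := Nat.exists_eq_add_of_le' hm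
  have hN0 : N ≠ 0 := by
    rintro rfl
    norm_num at hN
  obtain ⟨M, rfl⟩ := Nat.exists_eq_succ_of_ne_zero hN0
  have hL : X ^ (a + 1) + C r * X ^ a ≤ᶜ lapLeft (a + 1) r := by
    have h1 := zero_le_lapLeft (m := a + 1) hr.le
    have h2 : ∀ i ≤ a + 1, (geomPoly (a + 1)).coeff i = 1 := fun i hi => by
      simp [geomPoly, coeff_X_pow, hi]
    have hrm : ∀ i, r ^ i * r⁻¹ ^ i = 1 := fun i => by
      rw [← mul_pow, mul_inv_cancel₀ hr.ne', one_pow]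
    intro k
    rw [coeff_add, coeff_C_mul, coeff_X_pow, coeff_X_pow]
    by_cases hk : k = a + 1
    · rw [if_pos hk, if_neg (by omega), lapLeft, coeff_C_mul, comp_C_mul_X_coeff, h2 _ hk.le, hk]
      have := hrm (a + 1)
      linarith
    · rw [if_neg hk]
      by_cases hk' : k = a
      · rw [if_pos hk', lapLeft, coeff_C_mul, comp_C_mul_X_coeff, h2 _ (by omega), hk', pow_succ]
        have := hrm a
        apply le_of_eq
        linear_combination -r * this
      · rw [if_neg hk', mul_zero, add_zero]
        exact h1 k
  have hXr : 0 ≤ᶜ (X ^ (a + 1) + C r * X ^ a : ℝ[X]) :=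
    CoeffLE.zero_le_add (CoeffLE.zero_le_X_pow _)
      (CoeffLE.zero_le_mul (CoeffLE.zero_le_C hr.le) (CoeffLE.zero_le_X_pow _))
  have hP : 0 ≤ᶜ (C (α + κ) * X ^ (a + 1) : ℝ[X]) :=
    CoeffLE.zero_le_mul (CoeffLE.zero_le_C (by positivity)) (CoeffLE.zero_le_X_pow _)
  have hQ : 0 ≤ᶜ (C (κ * r) * X ^ a : ℝ[X]) :=
    CoeffLE.zero_le_mul (CoeffLE.zero_le_C (by positivity)) (CoeffLE.zero_le_X_pow _)
  have hb : C (α + κ) * X ^ (a + 1) + C (κ * r) * X ^ a ≤ᶜ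
      C α * X ^ (a + 1 + 0) + C κ * lapLeft (a + 1) r := by
    have := (CoeffLE.refl (C α * X ^ (a + 1))).add (CoeffLE.mul_left (CoeffLE.zero_le_C hκ) hL)
    convert this using 1
    simp only [C_mul, C_add]; ring
  have hpow : ∀ {P Q : ℝ[X]}, 0 ≤ᶜ P → P ≤ᶜ Q → ∀ n, P ^ n ≤ᶜ Q ^ n := by
    intro P Q hP h n
    induction n with
    | zero => simpa using CoeffLE.refl 1
    | succ n ih =>
      rw [pow_succ, pow_succ]
      exact (CoeffLE.mul_left (CoeffLE.zero_le_pow hP n) h).trans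
        (CoeffLE.mul_right (hP.trans h) ih)
  have hbin : ∀ {P Q : ℝ[X]}, 0 ≤ᶜ P → 0 ≤ᶜ Q →
      C ((M : ℝ) + 1) * (P ^ M * Q) ≤ᶜ (P + Q) ^ (M + 1) := by
    intro P Q hP hQ
    rw [add_pow]
    have := CoeffLE.single_le_sum (s := Finset.range (M + 1 + 1))
      (f := fun j => P ^ j * Q ^ (M + 1 - j) * ((M + 1).choose j : ℝ[X]))
      (fun i _ => CoeffLE.zero_le_mul (CoeffLE.zero_le_mul (CoeffLE.zero_le_pow hP _)
        (CoeffLE.zero_le_pow hQ _)) (CoeffLE.zero_le_natCast _)) (i := M) (by simp)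
    convert this using 1
    simp
    ring
  have h1 := (hbin hP hQ).trans (hpow (CoeffLE.zero_le_add hP hQ) hb (M + 1))
  have h2 := CoeffLE.mul_left (S := C δ * (C α * X ^ (a + 1 + 1)))
    (CoeffLE.zero_le_mul (CoeffLE.zero_le_C hδ) (CoeffLE.zero_le_mul (CoeffLE.zero_le_C hα)
      (CoeffLE.zero_le_X_pow _))) h1
  rw [mul_assoc (C δ) _ (_ ^ _)] at h2
  refine CoeffLE.trans ?_ h2
  have h3 : α * α ^ (M + 1) ≤ δ * (α * (((M : ℝ) + 1) * ((α + κ) ^ M * (κ * r)))) := by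
    simp only [Nat.succ_eq_add_one, Nat.add_sub_cancel] at hN
    push_cast at hN
    have h4 : α ^ M * (1 + κ) ^ M ≤ (α + κ) ^ M := by
      rw [← mul_pow]
      exact pow_le_pow_left₀ (by positivity) (by nlinarith) _
    calc α * α ^ (M + 1) = α * (α ^ M * α) := by rw [pow_succ]
      _ ≤ α * (α ^ M * (δ * r * (M + 1) * κ * (1 + κ) ^ M)) := by gcongr; linarith
      _ = δ * (α * (((M : ℝ) + 1) * ((α ^ M * (1 + κ) ^ M) * (κ * r)))) := by ring
      _ ≤ _ := by gcongr
  convert CoeffLE.C_mul_le_C_mul (P := X ^ (a + 1) * (X ^ (a + 1)) ^ (M + 1))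
    (CoeffLE.zero_le_mul (CoeffLE.zero_le_X_pow _) (CoeffLE.zero_le_pow (CoeffLE.zero_le_X_pow _) _))
    h3 using 1
  · simp only [binomTerm, Nat.choose_zero_right, Nat.sub_zero, Nat.cast_one, C_1, one_mul, pow_zero,
      mul_one, add_zero, C_mul, C_pow, Nat.succ_eq_add_one]
    ring
  · simp only [C_mul, C_pow]
    ring

/-- Summation of the bounds over the number of noisy users: each `Z * E i` is charged `1 + δ` by its
own index and `δ` by the previous one, and the head adds `δ Z F`, hence `1 + 3δ`. -/
theorem le_of_forall_term_le {A Z S F : ℝ[X]} {E : ℕ → ℝ[X]} {M : ℕ} (hδ : 0 ≤ δ)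
    (hE0 : ∀ i, 0 ≤ᶜ E i) (hZ0 : 0 ≤ᶜ Z) (hS0 : 0 ≤ᶜ S) (hlast : E (M + 3) = 0)
    (hEF : ∑ i ∈ Finset.range (M + 3), E i = F)
    (hterm : ∀ i, A * E (i + 1) ≤ᶜ C (1 + δ) * (Z * E (i + 1)) + C δ * (Z * E (i + 2)) +
      C δ * (S * E (i + 1)))
    (hhead : A * (E 0 + E 1) ≤ᶜ C (1 + δ) * (Z * E 1) + C δ * (Z * E 2) + C δ * (S * E 1) +
      C δ * (Z * F)) :
    A * F ≤ᶜ C (1 + (δ + δ + δ)) * (Z * F) + C δ * (S * F) := by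
  have hF1 : F = ∑ i ∈ Finset.range (M + 1), E (i + 2) + E 1 + E 0 := by
    rw [← hEF, Finset.sum_range_succ', Finset.sum_range_succ']
  have hF2 : F = ∑ i ∈ Finset.range (M + 1), E (i + 3) + E 2 + E 1 + E 0 := by
    rw [hF1, Finset.sum_range_succ (fun i => E (i + 3)), hlast, Finset.sum_range_succ']
    ring
  have htail := CoeffLE.sum (s := Finset.range (M + 1)) (fun i _ => hterm (i + 1))
  have hall := htail.add hhead
  have hE00 := hE0 0
  have e1 : ∑ i ∈ Finset.range (M + 1), E (i + 1 + 1) = F - E 1 - E 0 := by rw [hF1]; ring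
  have e2 : ∑ i ∈ Finset.range (M + 1), E (i + 1 + 2) = F - E 2 - E 1 - E 0 := by rw [hF2]; ring
  simp only [Finset.sum_add_distrib, ← Finset.mul_sum, e1, e2] at hall
  have e3 : A * (F - E 1 - E 0) + A * (E 0 + E 1) = A * F := by ring
  rw [e3] at hall
  refine hall.trans (CoeffLE.of_zero_le_sub ?_)
  have h5 : 0 ≤ᶜ C (1 + δ) * (Z * E 0) + C δ * (Z * (E 0 + E 1)) + C δ * (S * E 0) := by
    refine CoeffLE.zero_le_add (CoeffLE.zero_le_add ?_ ?_) ?_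
    · exact CoeffLE.zero_le_mul (CoeffLE.zero_le_C (by positivity)) (CoeffLE.zero_le_mul hZ0 hE00)
    · exact CoeffLE.zero_le_mul (CoeffLE.zero_le_C hδ)
        (CoeffLE.zero_le_mul hZ0 (CoeffLE.zero_le_add hE00 (hE0 1)))
    · exact CoeffLE.zero_le_mul (CoeffLE.zero_le_C hδ) (CoeffLE.zero_le_mul hS0 hE00)
  convert h5 using 1
  simp only [C_add, C_1]
  ring

theorem binomTerm_head_le {b N : ℕ} (hb : b ≤ 1) (hm : 1 ≤ m) (hr0 : 0 < r) (hr1 : r ≤ 1)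
    (hδ : 0 ≤ δ) (hri : r⁻¹ ≤ 1 + δ) (hκ : 0 ≤ κ) (hα : 0 ≤ α) (hα1 : α ≤ 1) (hN : 2 ≤ N)
    (h : 2 ≤ δ * r * m * κ * (N - 1)) (hNκ : 1 ≤ N * κ)
    (h3 : 1 ≤ δ * r * N * κ * (1 + κ) ^ (N - 1)) :
    C α * X ^ m * (binomTerm m r κ α b N 0 + binomTerm m r κ α b N 1) ≤ᶜ
      C (1 + δ) * (C α * X ^ (m + 1) * binomTerm m r κ α b N 1) +
      C δ * (C α * X ^ (m + 1) * binomTerm m r κ α b N 2) +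
      C δ * (C α * X ^ (m + 1) * (C α * X ^ (m + b) + C κ * lapLeft m r) ^ N) := by
  have hZ0 : 0 ≤ᶜ (C α * X ^ (m + 1) : ℝ[X]) :=
    CoeffLE.zero_le_mul (CoeffLE.zero_le_C hα) (CoeffLE.zero_le_X_pow _)
  have hrZ : C r⁻¹ * (C α * X ^ (m + 1) * binomTerm m r κ α b N 1) ≤ᶜ
      C (1 + δ) * (C α * X ^ (m + 1) * binomTerm m r κ α b N 1) :=
    CoeffLE.C_mul_le_C_mul (CoeffLE.zero_le_mul hZ0 (zero_le_binomTerm hr0.le hκ hα b N 1)) hri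
  have hF0 : 0 ≤ᶜ (C α * X ^ (m + b) + C κ * lapLeft m r) ^ N := by
    rw [← sum_binomTerm]
    exact CoeffLE.zero_le_sum fun i _ => zero_le_binomTerm hr0.le hκ hα b N i
  obtain rfl | rfl : b = 0 ∨ b = 1 := by omega
  · have h4 := binomTerm_zero_le hm hr0 hκ hα hα1 hδ h3
    have h5 := binomTerm_le (j := 0) hb hm hr0 hr1 hκ hα hα1 hN (by simpa using h)
    rw [mul_add, add_comm]
    exact (h5.trans (hrZ.add (CoeffLE.refl _))).add h4
  · refine CoeffLE.le_add_right ?_ ?_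
    · exact (binomTerm_zero_add_one_le hm hr0 hr1 hκ hα hα1 hN h hNκ).trans
        (hrZ.add (CoeffLE.refl _))
    · exact CoeffLE.zero_le_mul (CoeffLE.zero_le_C hδ) (CoeffLE.zero_le_mul hZ0 hF0)

theorem good_binomial {b N k₀ U : ℕ} (hb : b ≤ 1) (hδ : 0 < δ) (hκ : 0 ≤ κ) (hr0 : 0 < r)
    (hr1 : r ≤ 1) (hα : 0 ≤ α)
    (hα1 : α ≤ 1) (hr : 1 + δ / 2 ≤ (1 + δ) * r) (hk₀ : 20 ≤ k₀)
    (hm : 20 * ((m : ℝ) + 1) ≤ (1 + δ / 4) ^ m) (hUm : U ≤ m) (hUk : δ * U ≤ k₀)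
    (hU : 1 ≤ δ * κ * (1 + δ / 4) ^ U) (hkN : k₀ ≤ N) (hNκ : 1 ≤ N * κ)
    (h2 : (k₀ : ℝ) ≤ δ * r * m * κ * (N - k₀))
    (h3 : 1 ≤ δ * r * N * κ * (1 + κ) ^ (N - 1)) :
    Good m r κ α (δ + δ + δ) δ ((C α * X ^ (m + b) + C κ * lapLeft m r) ^ N) := by
  have hm1 : 1 ≤ m := by
    by_contra hcon
    obtain rfl : m = 0 := by omega
    norm_num at hm
  have hκ0 : 0 ≤ δ * r * m * κ := by positivity
  have hri : r⁻¹ ≤ 1 + δ := by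
    rw [inv_le_iff_one_le_mul₀ hr0]; linarith
  set E := binomTerm m r κ α b N with hE
  set Z : ℝ[X] := C α * X ^ (m + 1) with hZ
  set F := (C α * X ^ (m + b) + C κ * lapLeft m r) ^ N with hF
  set Nz := noisePoly m r κ with hNz
  have hE0 : ∀ i, 0 ≤ᶜ E i := fun i => zero_le_binomTerm hr0.le hκ hα b N i
  have hZ0 : 0 ≤ᶜ Z := CoeffLE.zero_le_mul (CoeffLE.zero_le_C hα) (CoeffLE.zero_le_X_pow _)
  have hNz0 : 0 ≤ᶜ Nz := zero_le_noisePoly hr0.le hκ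
  have hEF : ∑ i ∈ Finset.range (N + 1), E i = F := sum_binomTerm b N
  have hF0 : 0 ≤ᶜ F := hEF ▸ CoeffLE.zero_le_sum fun i _ => hE0 i
  -- Below the threshold `k₀` noisy users can be added profitably. From `k₀` on, `good_lapLeft_pow`
  -- applies.
  have hsmall : ∀ j : ℕ, j + 1 < k₀ → ((j : ℝ) + 2) ≤ δ * r * m * κ * (N - (j + 1)) := by
    intro j hj
    have hj' : ((j : ℝ) + 2) ≤ k₀ := by exact_mod_cast hj
    refine (hj'.trans h2).trans ?_
    gcongr
    linarith
  have hrZ : ∀ i, C r⁻¹ * (Z * E i) ≤ᶜ C (1 + δ) * (Z * E i) := fun i =>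
    CoeffLE.C_mul_le_C_mul (CoeffLE.zero_le_mul hZ0 (hE0 i)) hri
  have hterm : ∀ i, C α * X ^ m * E (i + 1) ≤ᶜ C (1 + δ) * (Z * E (i + 1)) +
      C δ * (Z * E (i + 2)) + C δ * (Nz * E (i + 1)) := by
    intro i
    by_cases hi : i + 1 < k₀
    · refine CoeffLE.le_add_right ?_
        (CoeffLE.zero_le_mul (CoeffLE.zero_le_C hδ.le) (CoeffLE.zero_le_mul hNz0 (hE0 _)))
      exact (binomTerm_le hb hm1 hr0 hr1 hκ hα hα1 (by omega) (hsmall i hi)).trans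
        ((hrZ _).add (CoeffLE.refl _))
    · have hg := (good_lapLeft_pow hδ hκ hr0 hα hα1 hr hk₀ (i := i + 1) (by omega) hm hUm hUk hU).mul
        (H := C (N.choose (i + 1) : ℝ) * (C α * X ^ (m + b)) ^ (N - (i + 1)) * C (κ ^ (i + 1)))
        (CoeffLE.zero_le_mul (CoeffLE.zero_le_mul (CoeffLE.zero_le_C (by positivity))
          (CoeffLE.zero_le_pow (CoeffLE.zero_le_mul (CoeffLE.zero_le_C hα)
            (CoeffLE.zero_le_X_pow _)) _)) (CoeffLE.zero_le_C (by positivity)))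
      have e : C (N.choose (i + 1) : ℝ) * (C α * X ^ (m + b)) ^ (N - (i + 1)) * C (κ ^ (i + 1)) *
          lapLeft m r ^ (i + 1) = E (i + 1) := by
        rw [hE, binomTerm, mul_pow (C κ), C_pow]; ring
      rw [e] at hg
      refine CoeffLE.trans hg ((CoeffLE.le_add_right (CoeffLE.refl _) ?_).add (CoeffLE.refl _))
      exact CoeffLE.zero_le_mul (CoeffLE.zero_le_C hδ.le) (CoeffLE.zero_le_mul hZ0 (hE0 _))
  have hhead : C α * X ^ m * (E 0 + E 1) ≤ᶜ C (1 + δ) * (Z * E 1) +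
      C δ * (Z * E 2) + C δ * (Nz * E 1) + C δ * (Z * F) := by
    have h1 := hsmall 0 (by omega)
    have h4 := binomTerm_head_le hb hm1 hr0 hr1 hδ.le hri hκ hα hα1 (by omega)
      (by simpa using h1) hNκ h3
    have h5 : 0 ≤ᶜ C δ * (Nz * E 1) :=
      CoeffLE.zero_le_mul (CoeffLE.zero_le_C hδ.le) (CoeffLE.zero_le_mul hNz0 (hE0 _))
    rw [add_right_comm]
    exact CoeffLE.le_add_right h4 h5
  obtain ⟨M, rfl⟩ : ∃ M, N = M + 2 := ⟨N - 2, by omega⟩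
  exact le_of_forall_term_le hδ.le hE0 hZ0 hNz0 (by simp [hE, binomTerm]) hEF hterm hhead

end ShuffledDP

/-! ### Users with noise in the upper half, and the one-sided comparison. -/

namespace ShuffledDP

open Polynomial

variable {m : ℕ} {r κ α δ : ℝ}

/-- The unnormalized generating polynomial of the number of ones sent by a user with input `b`. -/
noncomputable def userPoly (m : ℕ) (r κ α : ℝ) (b : ℕ) : ℝ[X] :=
  C α * X ^ (m + b) + noisePoly m r κ

theorem zero_le_userPoly (hr : 0 ≤ r) (hκ : 0 ≤ κ) (hα : 0 ≤ α) (b : ℕ) :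
    0 ≤ᶜ userPoly m r κ α b :=
  CoeffLE.zero_le_add (CoeffLE.zero_le_mul (CoeffLE.zero_le_C hα) (CoeffLE.zero_le_X_pow _))
    (zero_le_noisePoly hr hκ)

/-- For sums `Y` with `δ Y > 2 (k + h)`, one step changes the counts by at most `1 + δ/2`. For
smaller sums, `h` parts can be dropped at cost `8/δ` each. -/
theorem X_pow_mul_lapRight_pow_le {k h e : ℕ} (hδ : 0 < δ) (hδ1 : δ ≤ 1) (hr0 : 0 < r)
    (hrle : r ≤ 1) (hk : 20 ≤ k) (hkh : 3 * h ≤ k) (he : e ≤ h)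
    (hm : 20 * ((m : ℝ) + 1) ≤ (1 + δ / 4) ^ m) :
    X ^ e * lapRight m r ^ (k + h) ≤ᶜ C (1 + δ) * (X ^ (e + 1) * lapRight m r ^ (k + h)) +
      C ((8 / δ) ^ h * r⁻¹ ^ e) * lapRight m r ^ k := by
  have hkh' : 3 * (h : ℝ) ≤ k := by exact_mod_cast hkh
  have he' : (e : ℝ) ≤ h := by exact_mod_cast he
  have hr1 : 1 + δ / 2 ≤ (1 + δ) := by
    have : 0 ≤ δ := hδ.le
    linarith
  intro K
  simp only [coeff_C_mul, coeff_add, coeff_X_pow_mul', coeff_lapRight_pow]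
  have hck := comps_nonneg m k K
  by_cases hK : e ≤ K
  · obtain ⟨Y, rfl⟩ := Nat.exists_eq_add_of_le' hK
    rw [if_pos hK, Nat.add_sub_cancel]
    have e1 : (8 / δ) ^ h * r⁻¹ ^ e * (comps m k (Y + e) * r ^ (Y + e)) =
        r ^ Y * ((8 / δ) ^ h * comps m k (Y + e)) := by
      have : r⁻¹ ^ e * r ^ e = 1 := by rw [← mul_pow, inv_mul_cancel₀ hr0.ne', one_pow]
      rw [pow_add]
      linear_combination r ^ Y * ((8 / δ) ^ h * comps m k (Y + e)) * this
    rw [e1]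
    by_cases hY : δ * Y ≤ 2 * (k + h : ℕ)
    · have h1 : δ * (Y + e) ≤ 3 * k := by
        push_cast at hY
        have : δ * e ≤ e := mul_le_of_le_one_left (by positivity) hδ1
        linarith
      have h2 := comps_add_le_mul_comps (h := h) hδ hδ1 hk hm h1
      have h3 : 0 ≤ (1 + δ) * (if e + 1 ≤ Y + e then comps m (k + h) (Y + e - (e + 1)) *
          r ^ (Y + e - (e + 1)) else 0) := by
        have := comps_nonneg m (k + h) (Y + e - (e + 1))
        split_ifs <;> positivity
      have h4 : r ^ Y * comps m (k + h) Y ≤ r ^ Y * ((8 / δ) ^ h * comps m k (Y + e)) := by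
        gcongr
      linarith
    · push Not at hY
      have h2 : 0 ≤ r ^ Y * ((8 / δ) ^ h * comps m k (Y + e)) := by
        have := comps_nonneg m k (Y + e)
        positivity
      obtain ⟨Z, rfl⟩ : ∃ Z, Y = Z + 1 := by
        refine ⟨Y - 1, ?_⟩
        have : Y ≠ 0 := by
          rintro rfl
          have : (0 : ℝ) ≤ (k + h : ℕ) := by positivity
          simp at hY; norm_cast at hY
        omega
      rw [if_pos (by omega), show Z + 1 + e - (e + 1) = Z by omega]
      have h3 := comps_succ_le m (k + h) Z
      have hZ : (0 : ℝ) < (Z : ℝ) + 1 := by positivity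
      have hc' := comps_nonneg m (k + h) Z
      have h4 : ((Z : ℝ) + (k + h : ℕ)) * comps m (k + h) Z ≤
          ((Z : ℝ) + 1) * ((1 + δ / 2) * comps m (k + h) Z) := by
        rw [← mul_assoc]
        push_cast at hY ⊢
        gcongr
        linarith
      have h5 := le_of_mul_le_mul_left (h3.trans h4) hZ
      have hrδ : r * (1 + δ / 2) ≤ 1 + δ := by
        nlinarith
      have h6 : comps m (k + h) (Z + 1) * r ^ (Z + 1) ≤
          (1 + δ) * (comps m (k + h) Z * r ^ Z) :=
        calc comps m (k + h) (Z + 1) * r ^ (Z + 1)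
            ≤ ((1 + δ / 2) * comps m (k + h) Z) * r ^ (Z + 1) := by gcongr
          _ = (r * (1 + δ / 2)) * (comps m (k + h) Z * r ^ Z) := by ring
          _ ≤ _ := by gcongr
      linarith
  · rw [if_neg hK, if_neg (by omega)]
    simp; positivity

/-- The part of `userPoly ^ n` with `l` users whose noise is above `m`. -/
noncomputable def plusTerm (m : ℕ) (r κ α : ℝ) (b n l : ℕ) : ℝ[X] :=
  C (n.choose l : ℝ) * (C κ * (X ^ (m + 1) * lapRight m r)) ^ l *
    (C α * X ^ (m + b) + C κ * lapLeft m r) ^ (n - l)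

theorem sum_plusTerm (b n : ℕ) : ∑ l ∈ Finset.range (n + 1), plusTerm m r κ α b n l =
    userPoly m r κ α b ^ n := by
  have : userPoly m r κ α b = C κ * (X ^ (m + 1) * lapRight m r) +
      (C α * X ^ (m + b) + C κ * lapLeft m r) := by
    rw [userPoly, noisePoly]; ring
  rw [this, add_pow]
  refine Finset.sum_congr rfl fun i _ => ?_
  rw [plusTerm, C_eq_natCast]
  ring

theorem zero_le_leftPoly (hr : 0 ≤ r) (hκ : 0 ≤ κ) (hα : 0 ≤ α) (b : ℕ) :
    0 ≤ᶜ C α * X ^ (m + b) + C κ * lapLeft m r :=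
  CoeffLE.zero_le_add (CoeffLE.zero_le_mul (CoeffLE.zero_le_C hα) (CoeffLE.zero_le_X_pow _))
    (CoeffLE.zero_le_mul (CoeffLE.zero_le_C hκ) (zero_le_lapLeft hr))

theorem zero_le_plusPoly (hr : 0 ≤ r) (hκ : 0 ≤ κ) :
    0 ≤ᶜ C κ * (X ^ (m + 1) * lapRight m r) :=
  CoeffLE.zero_le_mul (CoeffLE.zero_le_C hκ)
    (CoeffLE.zero_le_mul (CoeffLE.zero_le_X_pow _) (zero_le_lapRight hr))

theorem zero_le_plusTerm (hr : 0 ≤ r) (hκ : 0 ≤ κ) (hα : 0 ≤ α) (b n l : ℕ) :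
    0 ≤ᶜ plusTerm m r κ α b n l :=
  CoeffLE.zero_le_mul (CoeffLE.zero_le_mul (CoeffLE.zero_le_C (by positivity))
    (CoeffLE.zero_le_pow (zero_le_plusPoly hr hκ) _))
    (CoeffLE.zero_le_pow (zero_le_leftPoly hr hκ hα b) _)

theorem choose_add_le {n k : ℕ} (h : ℕ) (hnk : n ≤ 4 * k) :
    (n.choose (k + h) : ℝ) ≤ 4 ^ h * n.choose k := by
  induction h with
  | zero => simp
  | succ h ih =>
    have h1 := Nat.choose_succ_right_eq n (k + h)
    have h2 : n.choose (k + h + 1) * (k + h + 1) ≤ 4 * n.choose (k + h) * (k + h + 1) := by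
      rw [h1, mul_comm 4, mul_assoc]
      exact Nat.mul_le_mul_left _ (by omega)
    have h3 : n.choose (k + h + 1) ≤ 4 * n.choose (k + h) :=
      Nat.le_of_mul_le_mul_right h2 (by omega)
    have h4 : (n.choose (k + h + 1) : ℝ) ≤ 4 * n.choose (k + h) := by exact_mod_cast h3
    rw [← add_assoc, pow_succ]
    linarith

theorem CoeffLE.pow_le_pow {P Q : ℝ[X]} (hP : 0 ≤ᶜ P) (h : P ≤ᶜ Q) (n : ℕ) :
    P ^ n ≤ᶜ Q ^ n := by
  induction n with
  | zero => simpa using CoeffLE.refl 1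
  | succ n ih =>
    rw [pow_succ, pow_succ]
    exact (CoeffLE.mul_left (CoeffLE.zero_le_pow hP n) h).trans
      (CoeffLE.mul_right (hP.trans h) ih)

/-- When many users have noise above `m`, either the counts are smooth or the configurations with
`h` fewer such users dominate. -/
theorem plusTerm_le {b n k h : ℕ} {τ : ℝ} (hb : b ≤ 1) (hδ : 0 < δ) (hδ1 : δ ≤ 1) (hr0 : 0 < r)
    (hr1 : r ≤ 1) (hκ : 0 ≤ κ) (hα : 0 < α) (hk : 20 ≤ k) (hkh : 3 * h ≤ k)
    (hm : 20 * ((m : ℝ) + 1) ≤ (1 + δ / 4) ^ m)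
    (hnk : n ≤ 4 * k) (hkn : k + h ≤ n) (hτ : (32 * κ / (δ * r * α)) ^ h ≤ τ) :
    C α * X ^ m * plusTerm m r κ α b n (k + h) ≤ᶜ
      C (1 + δ) * (C α * X ^ (m + 1) * plusTerm m r κ α b n (k + h)) +
      C τ * (C α * X ^ m * plusTerm m r κ α b n k) := by
  -- An upper-noise user has offset `m + 1` and a non-noisy one sends `m + b`, so exchanging `h` of
  -- them leaves `h (1 - b)` ones to be supplied by the other noisy users.
  have h1 := X_pow_mul_lapRight_pow_le (m := m) (e := h * (1 - b)) hδ hδ1 hr0 hr1 hk hkh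
    (by nlinarith [Nat.sub_le 1 b]) hm
  set F := C α * X ^ (m + b) + C κ * lapLeft m r with hF
  have hF0 : 0 ≤ᶜ F := zero_le_leftPoly hr0.le hκ hα.le b
  have hR := zero_le_lapRight (m := m) hr0.le
  have hA : 0 ≤ᶜ (C α * X ^ m : ℝ[X]) :=
    CoeffLE.zero_le_mul (CoeffLE.zero_le_C hα.le) (CoeffLE.zero_le_X_pow _)
  obtain ⟨j, rfl⟩ := Nat.exists_eq_add_of_le' hkn
  have hpre : 0 ≤ᶜ C ((j + (k + h)).choose (k + h) * κ ^ (k + h)) * X ^ ((m + 1) * k) * F ^ j *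
      (C α * X ^ m) * X ^ ((m + b) * h) :=
    CoeffLE.zero_le_mul (CoeffLE.zero_le_mul (CoeffLE.zero_le_mul (CoeffLE.zero_le_mul
      (CoeffLE.zero_le_C (by positivity)) (CoeffLE.zero_le_X_pow _)) (CoeffLE.zero_le_pow hF0 _)) hA)
      (CoeffLE.zero_le_X_pow _)
  have h2 := CoeffLE.mul_left hpre h1
  have hXe : X ^ ((m + 1) * k) * X ^ ((m + b) * h) * X ^ (h * (1 - b)) =
      (X ^ ((m + 1) * (k + h)) : ℝ[X]) := by
    rw [← pow_add, ← pow_add]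
    congr 1
    obtain rfl | rfl : b = 0 ∨ b = 1 := by omega
    · simp; ring
    · simp; ring
  have e1 : plusTerm m r κ α b (j + (k + h)) (k + h) =
      C ((j + (k + h)).choose (k + h) * κ ^ (k + h)) * X ^ ((m + 1) * (k + h)) * F ^ j *
        lapRight m r ^ (k + h) := by
    rw [plusTerm, Nat.add_sub_cancel, ← hF, C_mul, C_pow, pow_mul X (m + 1)]; ring
  have e2 : plusTerm m r κ α b (j + (k + h)) k =
      C ((j + (k + h)).choose k * κ ^ k) * X ^ ((m + 1) * k) * F ^ j * F ^ h *
        lapRight m r ^ k := by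
    rw [plusTerm, show j + (k + h) - k = j + h by omega, ← hF, C_mul, C_pow, pow_mul X (m + 1),
      pow_add F]; ring
  have hFh : (C α * X ^ (m + b)) ^ h ≤ᶜ F ^ h := by
    refine CoeffLE.pow_le_pow ?_ (CoeffLE.le_add_right (CoeffLE.refl _) ?_) h
    · exact CoeffLE.zero_le_mul (CoeffLE.zero_le_C hα.le) (CoeffLE.zero_le_X_pow _)
    · exact CoeffLE.zero_le_mul (CoeffLE.zero_le_C hκ) (zero_le_lapLeft hr0.le)
  have hτ0 : 0 ≤ τ := le_trans (by positivity) hτ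
  have hpre2 : 0 ≤ᶜ C τ * (C α * X ^ m) *
      (C ((j + (k + h)).choose k * κ ^ k) * X ^ ((m + 1) * k) * F ^ j * lapRight m r ^ k) :=
    CoeffLE.zero_le_mul (CoeffLE.zero_le_mul (CoeffLE.zero_le_C hτ0) hA)
      (CoeffLE.zero_le_mul (CoeffLE.zero_le_mul (CoeffLE.zero_le_mul
        (CoeffLE.zero_le_C (by positivity)) (CoeffLE.zero_le_X_pow _)) (CoeffLE.zero_le_pow hF0 _))
        (CoeffLE.zero_le_pow hR _))
  have h3 := CoeffLE.mul_left hpre2 hFh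
  -- Per exchanged user the cost is `4` for the binomial coefficient, `8/δ` for the counts, at most
  -- `r⁻¹` for the shift, and `κ/α` for the weights.
  have hnum : (j + (k + h)).choose (k + h) * κ ^ (k + h) *
      ((8 / δ) ^ h * r⁻¹ ^ (h * (1 - b))) ≤ τ * ((j + (k + h)).choose k * κ ^ k) * α ^ h := by
    have hch := choose_add_le h hnk
    have hri : 1 ≤ r⁻¹ := (one_le_inv₀ hr0).2 hr1
    have h5 : r⁻¹ ^ (h * (1 - b)) ≤ r⁻¹ ^ h :=
      pow_le_pow_right₀ hri (by nlinarith [Nat.sub_le 1 b])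
    calc (j + (k + h)).choose (k + h) * κ ^ (k + h) * ((8 / δ) ^ h * r⁻¹ ^ (h * (1 - b)))
        ≤ (4 ^ h * (j + (k + h)).choose k) * κ ^ (k + h) * ((8 / δ) ^ h * r⁻¹ ^ h) := by gcongr
      _ = (32 * κ / (δ * r * α)) ^ h * ((j + (k + h)).choose k * κ ^ k) * α ^ h := by
          have : 32 * κ / (δ * r * α) = 4 * κ * (8 / δ) * r⁻¹ * α⁻¹ := by
            field_simp; ring
          rw [this, mul_pow, mul_pow, mul_pow, mul_pow, pow_add]
          have : α⁻¹ ^ h * α ^ h = 1 := by rw [← mul_pow, inv_mul_cancel₀ hα.ne', one_pow]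
          linear_combination (-(4 ^ h * κ ^ h * (8 / δ) ^ h * r⁻¹ ^ h *
            ((j + (k + h)).choose k * κ ^ k))) * this
      _ ≤ _ := by gcongr
  have h4 := CoeffLE.C_mul_le_C_mul (P := X ^ ((m + 1) * k) * F ^ j * lapRight m r ^ k *
    (C α * X ^ m) * X ^ ((m + b) * h)) (CoeffLE.zero_le_mul (CoeffLE.zero_le_mul
      (CoeffLE.zero_le_mul (CoeffLE.zero_le_mul (CoeffLE.zero_le_X_pow _)
        (CoeffLE.zero_le_pow hF0 _)) (CoeffLE.zero_le_pow hR _)) hA) (CoeffLE.zero_le_X_pow _)) hnum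
  rw [e1, e2]
  have h3' : C (τ * ((j + (k + h)).choose k * κ ^ k) * α ^ h) * (X ^ ((m + 1) * k) * F ^ j *
      lapRight m r ^ k * (C α * X ^ m) * X ^ ((m + b) * h)) ≤ᶜ C τ * (C α * X ^ m *
      (C ((j + (k + h)).choose k * κ ^ k) * X ^ ((m + 1) * k) * F ^ j * F ^ h *
        lapRight m r ^ k)) := by
    convert h3 using 1
    · simp only [C_mul, C_pow, mul_pow, pow_mul]; ring
    · ring
  have h5 := h4.trans h3'
  set c1 : ℝ := (j + (k + h)).choose (k + h) * κ ^ (k + h)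
  set c2 : ℝ := (8 / δ) ^ h * r⁻¹ ^ (h * (1 - b))
  have e3 : C c1 * X ^ ((m + 1) * k) * F ^ j * (C α * X ^ m) * X ^ ((m + b) * h) *
      (X ^ (h * (1 - b)) * lapRight m r ^ (k + h)) =
      C α * X ^ m * (C c1 * X ^ ((m + 1) * (k + h)) * F ^ j * lapRight m r ^ (k + h)) := by
    linear_combination (C c1 * F ^ j * (C α * X ^ m) * lapRight m r ^ (k + h)) * hXe
  have e4 : C c1 * X ^ ((m + 1) * k) * F ^ j * (C α * X ^ m) * X ^ ((m + b) * h) *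
      (C (1 + δ) * (X ^ (h * (1 - b) + 1) * lapRight m r ^ (k + h)) +
        C c2 * lapRight m r ^ k) =
      C (1 + δ) * (C α * X ^ (m + 1) *
        (C c1 * X ^ ((m + 1) * (k + h)) * F ^ j * lapRight m r ^ (k + h))) +
      C (c1 * c2) * (X ^ ((m + 1) * k) * F ^ j * lapRight m r ^ k * (C α * X ^ m) *
        X ^ ((m + b) * h)) := by
    rw [C_mul (a := c1), pow_succ X (h * (1 - b)), pow_succ X m]
    linear_combination (C c1 * F ^ j * (C α * X ^ m) * lapRight m r ^ (k + h) * C (1 + δ) * X) * hXe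
  rw [e3, e4] at h2
  exact h2.trans ((CoeffLE.refl _).add h5)

theorem sum_shift_le {n h : ℕ} {f : ℕ → ℝ[X]} (hf : ∀ l, 0 ≤ᶜ f l) :
    ∑ l ∈ Finset.range (n + 1), (if h ≤ l then f (l - h) else 0) ≤ᶜ
      ∑ l ∈ Finset.range (n + 1), f l := by
  rw [← Finset.sum_filter]
  intro K
  simp only [finsetSum_coeff]
  rw [← Finset.sum_image (g := fun l => l - h) (f := fun l => (f l).coeff K)]
  · refine Finset.sum_le_sum_of_subset_of_nonneg ?_ fun i _ _ => by simpa using hf i K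
    intro l hl
    simp only [Finset.mem_image, Finset.mem_filter, Finset.mem_range] at hl ⊢
    omega
  · intro a ha b hb hab
    simp only [Finset.coe_filter, Finset.mem_range, Set.mem_ofPred_eq] at ha hb hab
    omega

/-- The parameters make the noise of a constant fraction of the `n` other users sufficient. -/
structure GoodParams (n m k₀ U h : ℕ) (r κ α δ τ : ℝ) : Prop where
  δ_pos : 0 < δ
  δ_le : δ ≤ 1
  κ_nonneg : 0 ≤ κ
  r_pos : 0 < r
  r_le : r ≤ 1
  α_pos : 0 < α
  α_le : α ≤ 1
  r_ge : 1 + δ / 2 ≤ (1 + δ) * r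
  k₀_ge : 20 ≤ k₀
  m_ge : 20 * ((m : ℝ) + 1) ≤ (1 + δ / 4) ^ m
  U_le : U ≤ m
  U_le' : δ * U ≤ k₀
  U_ge : 1 ≤ δ * κ * (1 + δ / 4) ^ U
  τ_ge : (32 * κ / (δ * r * α)) ^ h ≤ τ
  n_ge : 8 * (4 * h + 20) ≤ n
  many : ∀ N : ℕ, n ≤ 8 * N → k₀ ≤ N ∧ 1 ≤ N * κ ∧ (k₀ : ℝ) ≤ δ * r * m * κ * (N - k₀) ∧
    1 ≤ δ * r * N * κ * (1 + κ) ^ (N - 1)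

/-- If both groups have fewer than `n/8` users without upper noise, then `l₀ + l₁ > 3n/4`, so one of
`l₀`, `l₁` is at least `3n/8` and `plusTerm_le` applies to that group. Otherwise `good_binomial`
does. -/
theorem plusTerm_mul_le {n m k₀ U h : ℕ} {r κ α δ τ : ℝ} (hp : GoodParams n m k₀ U h r κ α δ τ)
    {n₀ n₁ l₀ l₁ : ℕ} (hn : n₀ + n₁ = n) (hl₀ : l₀ ≤ n₀) (hl₁ : l₁ ≤ n₁) :
    C α * X ^ m * (plusTerm m r κ α 0 n₀ l₀ * plusTerm m r κ α 1 n₁ l₁) ≤ᶜ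
      C (1 + (δ + δ + δ)) *
        (C α * X ^ (m + 1) * (plusTerm m r κ α 0 n₀ l₀ * plusTerm m r κ α 1 n₁ l₁)) +
      C δ * (noisePoly m r κ * (plusTerm m r κ α 0 n₀ l₀ * plusTerm m r κ α 1 n₁ l₁)) +
      C τ * (C α * X ^ m *
        ((if h ≤ l₀ then plusTerm m r κ α 0 n₀ (l₀ - h) else 0) * plusTerm m r κ α 1 n₁ l₁ +
         plusTerm m r κ α 0 n₀ l₀ * (if h ≤ l₁ then plusTerm m r κ α 1 n₁ (l₁ - h) else 0))) := by
  obtain ⟨hδ, hδ1, hκ, hr0, hr1, hα, hα1, hr, hk₀, hm, hUm, hUk, hU, hτ, hn8, hN⟩ := hp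
  have hτ0 : 0 ≤ τ := le_trans (by positivity) hτ
  set T₀ := plusTerm m r κ α 0 n₀ with hT₀
  set T₁ := plusTerm m r κ α 1 n₁ with hT₁
  have h0 : ∀ l, 0 ≤ᶜ T₀ l := zero_le_plusTerm hr0.le hκ hα.le 0 n₀
  have h1 : ∀ l, 0 ≤ᶜ T₁ l := zero_le_plusTerm hr0.le hκ hα.le 1 n₁
  have h0' : 0 ≤ᶜ (if h ≤ l₀ then T₀ (l₀ - h) else 0) := by
    split_ifs
    exacts [h0 _, CoeffLE.refl 0]
  have h1' : 0 ≤ᶜ (if h ≤ l₁ then T₁ (l₁ - h) else 0) := by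
    split_ifs
    exacts [h1 _, CoeffLE.refl 0]
  have hA : 0 ≤ᶜ (C α * X ^ m : ℝ[X]) :=
    CoeffLE.zero_le_mul (CoeffLE.zero_le_C hα.le) (CoeffLE.zero_le_X_pow _)
  have hZ : 0 ≤ᶜ (C α * X ^ (m + 1) : ℝ[X]) :=
    CoeffLE.zero_le_mul (CoeffLE.zero_le_C hα.le) (CoeffLE.zero_le_X_pow _)
  have hS : 0 ≤ᶜ noisePoly m r κ := zero_le_noisePoly hr0.le hκ
  have hrest : 0 ≤ᶜ C τ * (C α * X ^ m * ((if h ≤ l₀ then T₀ (l₀ - h) else 0) * T₁ l₁ +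
      T₀ l₀ * (if h ≤ l₁ then T₁ (l₁ - h) else 0))) :=
    CoeffLE.zero_le_mul (CoeffLE.zero_le_C hτ0) (CoeffLE.zero_le_mul hA (CoeffLE.zero_le_add
      (CoeffLE.zero_le_mul h0' (h1 _)) (CoeffLE.zero_le_mul (h0 _) h1')))
  have hnoise : 0 ≤ᶜ C δ * (noisePoly m r κ * (T₀ l₀ * T₁ l₁)) :=
    CoeffLE.zero_le_mul (CoeffLE.zero_le_C hδ.le)
      (CoeffLE.zero_le_mul hS (CoeffLE.zero_le_mul (h0 _) (h1 _)))
  have hmain : C (1 + δ) * (C α * X ^ (m + 1) * (T₀ l₀ * T₁ l₁)) ≤ᶜ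
      C (1 + (δ + δ + δ)) * (C α * X ^ (m + 1) * (T₀ l₀ * T₁ l₁)) :=
    CoeffLE.C_mul_le_C_mul (CoeffLE.zero_le_mul hZ (CoeffLE.zero_le_mul (h0 _) (h1 _)))
      (by linarith)
  have hgood : ∀ b n' l : ℕ, b ≤ 1 → n ≤ 8 * (n' - l) →
      Good m r κ α (δ + δ + δ) δ (plusTerm m r κ α b n' l) := by
    intro b n' l hb hl
    obtain ⟨a1, a2, a3, a4⟩ := hN (n' - l) hl
    exact (good_binomial hb hδ hκ hr0 hr1 hα.le hα1 hr hk₀ hm hUm hUk hU a1 a2 a3 a4).mul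
      (CoeffLE.zero_le_mul (CoeffLE.zero_le_C (by positivity))
        (CoeffLE.zero_le_pow (zero_le_plusPoly hr0.le hκ) _))
  by_cases c0 : n ≤ 8 * (n₀ - l₀)
  · refine CoeffLE.le_add_right ?_ hrest
    have := (hgood 0 n₀ l₀ (by omega) c0).mul (h1 l₁)
    rw [mul_comm (T₀ l₀)]
    exact this
  by_cases c1 : n ≤ 8 * (n₁ - l₁)
  · refine CoeffLE.le_add_right ?_ hrest
    exact (hgood 1 n₁ l₁ le_rfl c1).mul (h0 l₀)
  by_cases c2 : 3 * n ≤ 8 * l₀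
  · obtain ⟨k, rfl⟩ : ∃ k, l₀ = k + h := ⟨l₀ - h, by omega⟩
    have h2 := CoeffLE.mul_right (h1 l₁) (plusTerm_le (b := 0) (n := n₀) (k := k) (by omega) hδ hδ1
      hr0 hr1 hκ hα (by omega) (by omega) hm (by omega) hl₀ hτ)
    rw [if_pos (by omega), Nat.add_sub_cancel]
    have h3 : 0 ≤ᶜ C τ * (C α * X ^ m *
        (T₀ (k + h) * (if h ≤ l₁ then T₁ (l₁ - h) else 0))) :=
      CoeffLE.zero_le_mul (CoeffLE.zero_le_C hτ0) (CoeffLE.zero_le_mul hA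
        (CoeffLE.zero_le_mul (h0 _) h1'))
    rw [mul_add (C α * X ^ m), mul_add (C τ)]
    refine CoeffLE.trans ?_ ((CoeffLE.le_add_right hmain hnoise).add
      (CoeffLE.le_add_right (CoeffLE.refl _) h3))
    convert h2 using 1 <;> ring
  · obtain ⟨k, rfl⟩ : ∃ k, l₁ = k + h := ⟨l₁ - h, by omega⟩
    have h2 := CoeffLE.mul_left (h0 l₀) (plusTerm_le (b := 1) (n := n₁) (k := k) (by omega) hδ hδ1
      hr0 hr1 hκ hα (by omega) (by omega) hm (by omega) hl₁ hτ)
    rw [if_pos (c := h ≤ k + h) (by omega), Nat.add_sub_cancel]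
    have h3 : 0 ≤ᶜ C τ * (C α * X ^ m *
        ((if h ≤ l₀ then T₀ (l₀ - h) else 0) * T₁ (k + h))) :=
      CoeffLE.zero_le_mul (CoeffLE.zero_le_C hτ0) (CoeffLE.zero_le_mul hA
        (CoeffLE.zero_le_mul h0' (h1 _)))
    rw [mul_add (C α * X ^ m), mul_add (C τ), add_comm (C τ * _) (C τ * _)]
    refine CoeffLE.trans ?_ ((CoeffLE.le_add_right hmain hnoise).add
      (CoeffLE.le_add_right (CoeffLE.refl _) h3))
    convert h2 using 1 <;> ring

theorem userPoly_pow_mul_le {n m k₀ U h : ℕ} {r κ α δ τ : ℝ}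
    (hp : GoodParams n m k₀ U h r κ α δ τ) {n₀ n₁ : ℕ} (hn : n₀ + n₁ = n) {W : ℝ[X]}
    (hW : W = userPoly m r κ α 0 ^ n₀ * userPoly m r κ α 1 ^ n₁) :
    C α * X ^ m * W ≤ᶜ C (1 + (δ + δ + δ)) * (C α * X ^ (m + 1) * W) +
      C δ * (noisePoly m r κ * W) + C τ * (C α * X ^ m * (W + W)) := by
  have hτ0 : 0 ≤ τ := by
    have := hp.κ_nonneg
    have := hp.δ_pos
    have := hp.r_pos
    have := hp.α_pos
    exact le_trans (by positivity) hp.τ_ge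
  have hA : 0 ≤ᶜ (C α * X ^ m : ℝ[X]) :=
    CoeffLE.zero_le_mul (CoeffLE.zero_le_C hp.α_pos.le) (CoeffLE.zero_le_X_pow _)
  set T₀ := plusTerm m r κ α 0 n₀ with hT₀
  set T₁ := plusTerm m r κ α 1 n₁ with hT₁
  have h0 : ∀ l, 0 ≤ᶜ T₀ l := zero_le_plusTerm hp.r_pos.le hp.κ_nonneg hp.α_pos.le 0 n₀
  have h1 : ∀ l, 0 ≤ᶜ T₁ l := zero_le_plusTerm hp.r_pos.le hp.κ_nonneg hp.α_pos.le 1 n₁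
  have hs0 : ∑ l ∈ Finset.range (n₀ + 1), T₀ l = userPoly m r κ α 0 ^ n₀ := sum_plusTerm 0 n₀
  have hs1 : ∑ l ∈ Finset.range (n₁ + 1), T₁ l = userPoly m r κ α 1 ^ n₁ := sum_plusTerm 1 n₁
  have hW' : W = ∑ l₀ ∈ Finset.range (n₀ + 1), ∑ l₁ ∈ Finset.range (n₁ + 1), T₀ l₀ * T₁ l₁ := by
    rw [hW, ← hs0, ← hs1, Finset.sum_mul_sum]
  have hsum := CoeffLE.sum (s := Finset.range (n₀ + 1)) fun l₀ hl₀ =>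
    CoeffLE.sum (s := Finset.range (n₁ + 1)) fun l₁ hl₁ =>
      plusTerm_mul_le hp hn (Nat.lt_succ_iff.1 (Finset.mem_range.1 hl₀))
        (Nat.lt_succ_iff.1 (Finset.mem_range.1 hl₁))
  simp only [Finset.sum_add_distrib, ← Finset.mul_sum, ← hT₀, ← hT₁] at hsum
  simp only [← Finset.sum_mul] at hsum
  simp only [← Finset.sum_mul_sum] at hsum hW'
  have hP0 : 0 ≤ᶜ ∑ l ∈ Finset.range (n₀ + 1), T₀ l := CoeffLE.zero_le_sum fun l _ => h0 l
  have hP1 : 0 ≤ᶜ ∑ l ∈ Finset.range (n₁ + 1), T₁ l := CoeffLE.zero_le_sum fun l _ => h1 l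
  have hshift := (CoeffLE.mul_right hP1 (sum_shift_le (n := n₀) (h := h) h0)).add
    (CoeffLE.mul_left hP0 (sum_shift_le (n := n₁) (h := h) h1))
  rw [← hW'] at hsum hshift
  exact hsum.trans ((CoeffLE.refl _).add (CoeffLE.mul_left (CoeffLE.zero_le_C hτ0)
    (CoeffLE.mul_left hA hshift)))

/-- The term `2τ α X^m W` is absorbed on the left, which costs a division by `1 - ε/8`. The
remaining excess is within `ε` since `3δ = 3ε/8`. -/
theorem userPoly_zero_mul_le {n m k₀ U h : ℕ} {r κ α ε τ : ℝ}
    (hp : GoodParams n m k₀ U h r κ α (ε / 8) τ) (hε1 : ε ≤ 1) (hτ : τ ≤ ε / 16) {n₀ n₁ : ℕ}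
    (hn : n₀ + n₁ = n) {W : ℝ[X]}
    (hW : W = userPoly m r κ α 0 ^ n₀ * userPoly m r κ α 1 ^ n₁) :
    userPoly m r κ α 0 * W ≤ᶜ C (1 + ε) * (userPoly m r κ α 1 * W) := by
  have hε0 : 0 < ε := by linarith [hp.δ_pos]
  have hW0 : 0 ≤ᶜ W := by
    rw [hW]
    exact CoeffLE.zero_le_mul
      (CoeffLE.zero_le_pow (zero_le_userPoly hp.r_pos.le hp.κ_nonneg hp.α_pos.le _) _)
      (CoeffLE.zero_le_pow (zero_le_userPoly hp.r_pos.le hp.κ_nonneg hp.α_pos.le _) _)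
  have hmon : ∀ i, 0 ≤ᶜ C α * X ^ i * W := fun i => CoeffLE.zero_le_mul
    (CoeffLE.zero_le_mul (CoeffLE.zero_le_C hp.α_pos.le) (CoeffLE.zero_le_X_pow _)) hW0
  intro K
  have h1 := userPoly_pow_mul_le hp hn hW K
  have h2 : 0 ≤ (C α * X ^ m * W).coeff K := by simpa using hmon m K
  have h3 : 0 ≤ (C α * X ^ (m + 1) * W).coeff K := by simpa using hmon (m + 1) K
  have h4 : 0 ≤ (noisePoly m r κ * W).coeff K := by
    simpa using CoeffLE.zero_le_mul (zero_le_noisePoly hp.r_pos.le hp.κ_nonneg) hW0 K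
  simp only [userPoly, add_zero, add_mul, coeff_add, coeff_C_mul, mul_add] at h1 ⊢
  simp only [mul_assoc, coeff_C_mul] at h1 h2 h3 h4 ⊢
  set a := α * (X ^ m * W).coeff K
  set b := α * (X ^ (m + 1) * W).coeff K
  set c := (noisePoly m r κ * W).coeff K
  have h5 : τ * (a + a) ≤ ε / 16 * (a + a) := by gcongr
  have h6 : 0 ≤ (1 - ε / 8) * ((1 + ε) * b + ε * c - a) := by
    have e1 : 0 ≤ (ε / 2 - ε * ε / 8) * b := mul_nonneg (by nlinarith) h3
    have e2 : 0 ≤ (ε - ε / 8 - ε * ε / 8) * c := mul_nonneg (by nlinarith) h4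
    linarith
  have h7 := nonneg_of_mul_nonneg_right h6 (by linarith)
  linarith


end ShuffledDP

/-! ### Reduction of the shuffled view to the number of ones. -/

namespace ShuffledDP

open Polynomial

theorem map_mul_left_uniformOfFintype {G : Type*} [Group G] [Fintype G] [Nonempty G] (g : G) :
    (PMF.uniformOfFintype G).map (fun x => g * x) = PMF.uniformOfFintype G := by
  ext x
  rw [PMF.map_apply, tsum_eq_single (g⁻¹ * x)]
  · simp
  · intro y hy
    rw [if_neg]
    rintro rfl
    simp at hy

theorem shuffler_eq {Msg : Type*} {n : ℕ} (l : List Msg) (h : l.length = n) :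
    shuffler l = (PMF.uniformOfFintype (Equiv.Perm (Fin n))).map
      fun σ => List.ofFn fun i => l.get (Fin.cast h.symm (σ i)) := by
  subst h
  rfl

/-- Sorting both lists exhibits one as a rearrangement of the other by an explicit permutation, and
the uniform law on permutations is invariant under left translation. -/
theorem shuffler_eq_of_perm {l l' : List Bool} (h : l.Perm l') : shuffler l = shuffler l' := by
  have hn : l'.length = l.length := h.length_eq.symm
  rw [shuffler_eq l rfl, shuffler_eq l' hn]
  set n := l.length
  set f : Fin n → Bool := fun i => l.get i with hf
  set f' : Fin n → Bool := fun i => l'.get (Fin.cast hn.symm i) with hf'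
  have hl : List.ofFn f = l := List.ofFn_get l
  have hl' : List.ofFn f' = l' := by
    apply List.ext_get
    · simp [hn]
    · intro i h1 h2
      simp [hf']
  have h1 : (List.ofFn (f ∘ Tuple.sort f)).Perm (List.ofFn (f' ∘ Tuple.sort f')) := by
    refine (Equiv.Perm.ofFn_comp_perm _ _).trans (List.Perm.trans ?_
      (Equiv.Perm.ofFn_comp_perm _ _).symm)
    rw [hl, hl']
    exact h
  have h2 : List.ofFn (f ∘ Tuple.sort f) = List.ofFn (f' ∘ Tuple.sort f') := by
    refine h1.eq_of_sortedLE ?_ ?_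
    · exact List.sortedLE_ofFn_iff.2 (Tuple.monotone_sort f)
    · exact List.sortedLE_ofFn_iff.2 (Tuple.monotone_sort f')
  have h3 := List.ofFn_injective h2
  have h4 : ∀ i, f' i = f ((Tuple.sort f * (Tuple.sort f')⁻¹) i) := by
    intro i
    have := congrFun h3 ((Tuple.sort f')⁻¹ i)
    have hi : Tuple.sort f' ((Tuple.sort f')⁻¹ i) = i := Equiv.apply_symm_apply _ _
    simp only [Function.comp_apply, hi] at this
    rw [Equiv.Perm.mul_apply, ← this]
  have h5 : (fun σ : Equiv.Perm (Fin n) => List.ofFn fun i => l'.get (Fin.cast hn.symm (σ i))) =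
      (fun σ => List.ofFn fun i => l.get (Fin.cast rfl (σ i))) ∘
        (fun σ => (Tuple.sort f * (Tuple.sort f')⁻¹) * σ) := by
    funext σ
    simp only [Function.comp_apply]
    congr 1
    funext i
    exact h4 (σ i)
  rw [h5, ← PMF.map_comp, map_mul_left_uniformOfFintype]

theorem perm_of_mem_support_shuffler {Msg : Type*} {l v : List Msg}
    (h : v ∈ (shuffler l).support) : v.Perm l := by
  rw [shuffler, PMF.mem_support_map_iff] at h
  obtain ⟨σ, -, rfl⟩ := h
  have := Equiv.Perm.ofFn_comp_perm σ l.get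
  rw [List.ofFn_get] at this
  exact this

theorem count_bits (a b : ℕ) : (bits a b).count true = a := by
  simp [bits, List.count_replicate]

theorem length_bits (a b : ℕ) : (bits a b).length = a + b := by simp [bits]

theorem perm_bits {l : List Bool} {D : ℕ} (h : l.length = D) :
    l.Perm (bits (l.count true) (D - l.count true)) := by
  rw [List.perm_iff_count]
  have h1 := List.count_true_add_count_false l
  rintro (_ | _)
  · simp [bits, List.count_replicate]; omega
  · rw [count_bits]

theorem length_of_mem_support_runUsers {X Msg : Type*} {R : X → PMF (List Msg)} {d : ℕ}
    (hR : ∀ x, ∀ l ∈ (R x).support, l.length = d) (xs : List X) :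
    ∀ l ∈ (runUsers R xs).support, l.length = d * xs.length := by
  induction xs with
  | nil => simp [runUsers]
  | cons x xs ih =>
    intro l hl
    rw [runUsers, PMF.mem_support_bind_iff] at hl
    obtain ⟨a, ha, hl⟩ := hl
    rw [PMF.mem_support_map_iff] at hl
    obtain ⟨b, hb, rfl⟩ := hl
    rw [List.length_append, hR x a ha, ih b hb, List.length_cons]
    ring

theorem bind_congr_support {α β : Type*} {p : PMF α} {f g : α → PMF β}
    (h : ∀ a ∈ p.support, f a = g a) : p.bind f = p.bind g := by
  ext b
  rw [PMF.bind_apply, PMF.bind_apply]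
  refine tsum_congr fun a => ?_
  by_cases ha : a ∈ p.support
  · rw [h a ha]
  · rw [PMF.mem_support_iff, not_not] at ha
    simp [ha]

/-- The distribution of the total number of ones that the users send. -/
noncomputable def countPMF {X : Type*} (R : X → PMF (List Bool)) (xs : List X) : PMF ℕ :=
  (runUsers R xs).map (List.count true)

/-- The number of ones is a sufficient statistic: the view is obtained from it by a randomization
independent of the inputs. -/
theorem view_eq_bind_countPMF {X Out : Type*} {P : Protocol X Bool Out} {d n : ℕ}
    (hP : P.Sends d) (x : Fin n → X) :
    P.view x = (countPMF P.randomizer (List.ofFn x)).bind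
      fun c => shuffler (bits c (d * n - c)) := by
  rw [countPMF, PMF.bind_map, Protocol.view]
  refine bind_congr_support fun l hl => ?_
  have := length_of_mem_support_runUsers hP _ l hl
  rw [List.length_ofFn] at this
  exact shuffler_eq_of_perm (perm_bits this)

theorem isShuffledDP_of_countPMF_le {X Out : Type*} {P : Protocol X Bool Out} {d n : ℕ} {ε : ℝ}
    (hP : P.Sends d) (h : ∀ x x' : Fin n → X, Neighbors x x' → ∀ k,
      countPMF P.randomizer (List.ofFn x) k ≤
        ENNReal.ofReal (Real.exp ε) * countPMF P.randomizer (List.ofFn x') k) :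
    P.IsShuffledDP n ε := by
  intro x x' hx S
  simp only [view_eq_bind_countPMF hP, PMF.toOuterMeasure_bind_apply]
  rw [← ENNReal.tsum_mul_left]
  refine ENNReal.tsum_le_tsum fun k => ?_
  rw [← mul_assoc]
  gcongr
  exact h x x' hx k

theorem tsum_mul_comp {α β : Type*} (p : PMF α) (f : α → β) (g : β → ℝ≥0∞) :
    ∑' a, p a * g (f a) = ∑' b, (p.map f) b * g b := by
  simp only [PMF.map_apply, ← ENNReal.tsum_mul_right]
  rw [ENNReal.tsum_comm]
  refine tsum_congr fun a => ?_
  rw [tsum_eq_single (f a)]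
  · simp
  · intro b hb
    rw [if_neg hb, zero_mul]

theorem map_count_view {X Out : Type*} (P : Protocol X Bool Out) {n : ℕ} (x : Fin n → X) :
    (P.view x).map (List.count true) = countPMF P.randomizer (List.ofFn x) := by
  rw [Protocol.view, PMF.map_bind, countPMF, ← PMF.bind_pure_comp]
  refine bind_congr_support fun l _ => ?_
  rw [← PMF.bind_pure_comp, bind_congr_support (g := fun _ => PMF.pure (l.count true)),
    PMF.bind_const]
  · rfl
  · intro v hv
    simp only [Function.comp_apply]
    rw [(perm_of_mem_support_shuffler hv).count_eq]

theorem length_of_mem_support_view {X Msg Out : Type*} {P : Protocol X Msg Out} {d n : ℕ}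
    (hP : P.Sends d) {x : Fin n → X} {v : List Msg} (hv : v ∈ (P.view x).support) :
    v.length = d * n := by
  rw [Protocol.view, PMF.mem_support_bind_iff] at hv
  obtain ⟨l, hl, hv⟩ := hv
  rw [(perm_of_mem_support_shuffler hv).length_eq, length_of_mem_support_runUsers hP _ l hl,
    List.length_ofFn]

theorem countPMF_apply {X : Type*} {R : X → PMF (List Bool)} {P : X → ℝ[X]}
    (hP : ∀ x, 0 ≤ᶜ P x)
    (hR : ∀ x k, (R x).map (List.count true) k = ENNReal.ofReal ((P x).coeff k)) (xs : List X)
    (k : ℕ) : countPMF R xs k = ENNReal.ofReal ((xs.map P).prod.coeff k) := by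
  induction xs generalizing k with
  | nil =>
    rw [countPMF, runUsers, PMF.pure_map]
    simp only [PMF.pure_apply, List.map_nil, List.prod_nil, coeff_one, List.count_nil]
    split_ifs <;> simp
  | cons x xs ih =>
    have h1 : countPMF R (x :: xs) = ((R x).map (List.count true)).bind fun c =>
        (countPMF R xs).map fun c' => c + c' := by
      rw [countPMF, runUsers, PMF.map_bind, PMF.bind_map]
      refine bind_congr_support fun l _ => ?_
      rw [Function.comp_apply, countPMF, PMF.map_comp, PMF.map_comp]
      congr 1
      funext l'
      simp
    have hxs : 0 ≤ᶜ (xs.map P).prod := by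
      clear ih h1
      induction xs with
      | nil => simpa using CoeffLE.zero_le_pow (CoeffLE.refl 0) 0
      | cons y ys ih => rw [List.map_cons, List.prod_cons]; exact CoeffLE.zero_le_mul (hP y) ih
    have h2 : ∀ c, ((countPMF R xs).map fun c' => c + c') k =
        if c ≤ k then countPMF R xs (k - c) else 0 := by
      intro c
      rw [PMF.map_apply]
      split_ifs with hc
      · rw [tsum_eq_single (k - c)]
        · rw [if_pos (by omega)]
        · intro b hb
          rw [if_neg (by omega)]
      · rw [ENNReal.tsum_eq_zero]
        intro b
        rw [if_neg (by omega)]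
    rw [h1, PMF.bind_apply, tsum_eq_sum (s := Finset.range (k + 1)), List.map_cons, List.prod_cons,
      coeff_mul, Finset.Nat.sum_antidiagonal_eq_sum_range_succ_mk, ENNReal.ofReal_sum_of_nonneg]
    · refine Finset.sum_congr rfl fun c hc => ?_
      have hc' := Nat.lt_succ_iff.1 (Finset.mem_range.1 hc)
      rw [h2, if_pos hc', hR, ih, ENNReal.ofReal_mul (by simpa using hP x c)]
    · intro c _
      exact mul_nonneg (by simpa using hP x c) (by simpa using hxs _)
    · intro c hc
      rw [h2, if_neg (by simpa [Nat.lt_succ_iff] using hc), mul_zero]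

end ShuffledDP

/-! ### Reflection symmetry, the law of the randomizer, and privacy. -/

namespace ShuffledDP

open Polynomial

variable {m : ℕ} {r κ α : ℝ}

/-- The unnormalized weights of the truncated discrete Laplace distribution on `{0, …, 2m + 1}`. -/
noncomputable def lapWeight (m : ℕ) (r : ℝ) (k : ℕ) : ℝ :=
  if k ≤ m then r ^ (m - k) else if k ≤ 2 * m + 1 then r ^ (k - (m + 1)) else 0

theorem coeff_geomPoly (m k : ℕ) : (geomPoly m).coeff k = if k ≤ m then 1 else 0 := by
  simp [geomPoly, coeff_X_pow]

theorem coeff_noisePoly (hr : r ≠ 0) (k : ℕ) :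
    (noisePoly m r κ).coeff k = κ * lapWeight m r k := by
  rw [noisePoly, coeff_C_mul, coeff_add, lapLeft, coeff_C_mul, comp_C_mul_X_coeff,
    coeff_X_pow_mul', lapRight, comp_C_mul_X_coeff, coeff_geomPoly, coeff_geomPoly, lapWeight]
  congr 1
  by_cases hk : k ≤ m
  · obtain ⟨j, rfl⟩ := Nat.exists_eq_add_of_le' hk
    rw [if_pos hk, if_pos hk, if_neg (by omega), Nat.add_sub_cancel, pow_add, inv_pow]
    field_simp
    simp
  · rw [if_neg hk, if_neg hk, if_pos (by omega)]
    by_cases hk2 : k ≤ 2 * m + 1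
    · rw [if_pos hk2, if_pos (by omega)]; ring
    · rw [if_neg hk2, if_neg (by omega)]; ring

theorem coeff_userPoly (hr : r ≠ 0) (b k : ℕ) :
    (userPoly m r κ α b).coeff k = (if k = m + b then α else 0) + κ * lapWeight m r k := by
  rw [userPoly, coeff_add, coeff_noisePoly hr, coeff_C_mul, coeff_X_pow]
  split_ifs <;> simp

theorem natDegree_userPoly_le (hr : r ≠ 0) {b : ℕ} (hb : b ≤ 1) :
    (userPoly m r κ α b).natDegree ≤ 2 * m + 1 := by
  rw [natDegree_le_iff_coeff_eq_zero]
  intro k hk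
  rw [coeff_userPoly hr, lapWeight, if_neg (by omega), if_neg (by omega), if_neg (by omega)]
  simp

theorem lapWeight_reflect {k : ℕ} (hk : k ≤ 2 * m + 1) :
    lapWeight m r (2 * m + 1 - k) = lapWeight m r k := by
  unfold lapWeight
  by_cases hk2 : k ≤ m
  · rw [if_neg (by omega), if_pos (by omega), if_pos hk2]
    congr 1
    omega
  · rw [if_pos (by omega), if_neg hk2, if_pos hk]
    congr 1
    omega

theorem reflect_userPoly (hr : r ≠ 0) {b : ℕ} (hb : b ≤ 1) :
    reflect (2 * m + 1) (userPoly m r κ α b) = userPoly m r κ α (1 - b) := by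
  ext k
  rw [coeff_reflect, coeff_userPoly hr, coeff_userPoly hr]
  by_cases hk : k ≤ 2 * m + 1
  · rw [revAt_le hk, lapWeight_reflect hk]
    congr 1
    by_cases h : k = m + (1 - b)
    · rw [if_pos h, if_pos (by omega)]
    · rw [if_neg h, if_neg (by omega)]
  · rw [revAt_eq_self_of_lt (by omega)]
    congr 1
    rw [if_neg (by omega), if_neg (by omega)]

theorem reflect_pow (f : ℝ[X]) {N : ℕ} (hf : f.natDegree ≤ N) (k : ℕ) :
    reflect (k * N) (f ^ k) = reflect N f ^ k := by
  induction k with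
  | zero =>
    simp
  | succ k ih =>
    rw [pow_succ, pow_succ, add_mul, one_mul, reflect_mul _ _ _ hf, ih]
    exact natDegree_pow_le_of_le k hf

/-- Exchanging ones and zeros maps `userPoly 0` to `userPoly 1` and back, so this is the other
direction with `n₀` and `n₁` interchanged, read at the reflected index. -/
theorem userPoly_one_mul_le {n m k₀ U h : ℕ} {r κ α ε τ : ℝ}
    (hp : GoodParams n m k₀ U h r κ α (ε / 8) τ) (hε1 : ε ≤ 1) (hτ : τ ≤ ε / 16) {n₀ n₁ : ℕ}
    (hn : n₀ + n₁ = n) {W : ℝ[X]}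
    (hW : W = userPoly m r κ α 0 ^ n₀ * userPoly m r κ α 1 ^ n₁) :
    userPoly m r κ α 1 * W ≤ᶜ C (1 + ε) * (userPoly m r κ α 0 * W) := by
  have hr := hp.r_pos.ne'
  have h := userPoly_zero_mul_le hp hε1 hτ (n₀ := n₁) (n₁ := n₀) (by omega) rfl
  have hd : ∀ b ≤ 1, ∀ k, (userPoly m r κ α b ^ k).natDegree ≤ k * (2 * m + 1) := fun b hb k =>
    natDegree_pow_le_of_le k (natDegree_userPoly_le hr hb)
  have hrefl : ∀ b ≤ 1, reflect ((2 * m + 1) + (n₁ * (2 * m + 1) + n₀ * (2 * m + 1)))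
      (userPoly m r κ α b * (userPoly m r κ α 0 ^ n₁ * userPoly m r κ α 1 ^ n₀)) =
      userPoly m r κ α (1 - b) * W := by
    intro b hb
    rw [reflect_mul _ _ (natDegree_userPoly_le hr hb) (natDegree_mul_le_of_le (hd 0 (by omega) n₁)
      (hd 1 le_rfl n₀)), reflect_mul _ _ (hd 0 (by omega) n₁) (hd 1 le_rfl n₀),
      reflect_pow _ (natDegree_userPoly_le hr (by omega)),
      reflect_pow _ (natDegree_userPoly_le hr le_rfl), reflect_userPoly hr hb,
      reflect_userPoly hr (by omega), reflect_userPoly hr le_rfl, hW]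
    rw [mul_comm (_ ^ n₁)]
  intro K
  have h2 := h (revAt ((2 * m + 1) + (n₁ * (2 * m + 1) + n₀ * (2 * m + 1))) K)
  rw [coeff_C_mul, ← coeff_reflect, ← coeff_reflect, hrefl 0 (by omega), hrefl 1 le_rfl] at h2
  rwa [coeff_C_mul]

/-- The index of the non-noisy message of a bit. -/
def bitIndex (x : Bool) : ℕ := if x then 1 else 0

theorem prod_userPoly_eq {ι : Type*} (s : Finset ι) (x : ι → Bool) :
    ∃ n₀ n₁ : ℕ, n₀ + n₁ = s.card ∧ ∏ j ∈ s, userPoly m r κ α (bitIndex (x j)) =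
      userPoly m r κ α 0 ^ n₀ * userPoly m r κ α 1 ^ n₁ := by
  classical
  induction s using Finset.induction_on with
  | empty => exact ⟨0, 0, by simp⟩
  | insert a s ha ih =>
    obtain ⟨n₀, n₁, h1, h2⟩ := ih
    rw [Finset.prod_insert ha, h2, Finset.card_insert_of_notMem ha]
    cases hx : x a
    · exact ⟨n₀ + 1, n₁, by omega, by simp [bitIndex]; ring⟩
    · exact ⟨n₀, n₁ + 1, by omega, by simp [bitIndex]; ring⟩

theorem prod_userPoly_le {n m k₀ U h : ℕ} {r κ α ε τ : ℝ}
    (hp : GoodParams (n - 1) m k₀ U h r κ α (ε / 8) τ) (hε1 : ε ≤ 1) (hτ : τ ≤ ε / 16)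
    {x x' : Fin n → Bool} (hx : Neighbors x x') :
    ∏ j, userPoly m r κ α (bitIndex (x j)) ≤ᶜ
      C (1 + ε) * ∏ j, userPoly m r κ α (bitIndex (x' j)) := by
  have hε0 : 0 < ε := by linarith [hp.δ_pos]
  have hP : ∀ b, 0 ≤ᶜ userPoly m r κ α b :=
    zero_le_userPoly hp.r_pos.le hp.κ_nonneg hp.α_pos.le
  obtain ⟨i, hi⟩ := hx
  obtain ⟨n₀, n₁, h1, h2⟩ := prod_userPoly_eq (m := m) (r := r) (κ := κ) (α := α)
    (Finset.univ.erase i) x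
  rw [Finset.card_erase_of_mem (Finset.mem_univ i), Finset.card_univ, Fintype.card_fin] at h1
  have h3 : ∏ j ∈ Finset.univ.erase i, userPoly m r κ α (bitIndex (x' j)) =
      ∏ j ∈ Finset.univ.erase i, userPoly m r κ α (bitIndex (x j)) :=
    Finset.prod_congr rfl fun j hj => by rw [hi j (Finset.ne_of_mem_erase hj)]
  rw [← Finset.mul_prod_erase _ _ (Finset.mem_univ i),
    ← Finset.mul_prod_erase _ (fun j => userPoly m r κ α (bitIndex (x' j))) (Finset.mem_univ i), h3]
  set W := ∏ j ∈ Finset.univ.erase i, userPoly m r κ α (bitIndex (x j))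
  have hW0 : 0 ≤ᶜ W := by
    rw [h2]
    exact CoeffLE.zero_le_mul (CoeffLE.zero_le_pow (hP _) _) (CoeffLE.zero_le_pow (hP _) _)
  have hrefl : ∀ b, userPoly m r κ α b * W ≤ᶜ C (1 + ε) * (userPoly m r κ α b * W) := fun b => by
    have := CoeffLE.C_mul_le_C_mul (CoeffLE.zero_le_mul (hP b) hW0) (a := 1) (b := 1 + ε)
      (by linarith)
    simpa using this
  cases x i <;> cases x' i
  · exact hrefl _
  · exact userPoly_zero_mul_le hp hε1 hτ h1 h2
  · exact userPoly_one_mul_le hp hε1 hτ h1 h2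
  · exact hrefl _

theorem sum_lapWeight (m : ℕ) (r : ℝ) : ∑ k ∈ Finset.range (2 * m + 2), lapWeight m r k =
    2 * ∑ v ∈ Finset.range (m + 1), r ^ v := by
  rw [show 2 * m + 2 = (m + 1) + (m + 1) by ring, Finset.sum_range_add, two_mul]
  congr 1
  · rw [← Finset.sum_range_reflect]
    refine Finset.sum_congr rfl fun k hk => ?_
    have := Finset.mem_range.1 hk
    rw [lapWeight, if_pos (by omega)]
    congr 1
    omega
  · refine Finset.sum_congr rfl fun k hk => ?_
    have := Finset.mem_range.1 hk
    rw [lapWeight, if_neg (by omega), if_pos (by omega)]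
    congr 1
    omega

theorem lapWeight_nonneg (hr : 0 ≤ r) (k : ℕ) : 0 ≤ lapWeight m r k := by
  unfold lapWeight; split_ifs <;> positivity

/-- The centre `d/2 = m + 1/2` is a half-integer. The distance `1/2` to the nearest integers gives
the common factor, which normalization removes. -/
theorem laplaceWeight_eq (m : ℕ) (s : ℝ) (z : Fin (2 * m + 1 + 1)) :
    laplaceWeight (2 * m + 1) s z = ENNReal.ofReal
      (Real.exp (-1 / (2 * s)) * lapWeight m (Real.exp (-1 / s)) z) := by
  rw [laplaceWeight]
  congr 1
  have hz := z.2
  unfold lapWeight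
  by_cases hk : (z : ℕ) ≤ m
  · rw [if_pos hk, ← Real.exp_nat_mul, ← Real.exp_add, Nat.cast_sub hk]
    congr 1
    have : ((z : ℕ) : ℝ) ≤ m := by exact_mod_cast hk
    rw [abs_of_nonpos (by push_cast; linarith)]
    push_cast
    ring
  · rw [if_neg hk, if_pos (by omega), ← Real.exp_nat_mul, ← Real.exp_add,
      Nat.cast_sub (by omega)]
    congr 1
    have : (m : ℝ) + 1 ≤ ((z : ℕ) : ℝ) := by exact_mod_cast (by omega)
    rw [abs_of_nonneg (by push_cast; linarith)]
    push_cast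
    ring

theorem truncLaplace_map_val (m : ℕ) (s : ℝ) (k : ℕ) :
    (truncLaplace (2 * m + 1) s).map (fun z : Fin (2 * m + 1 + 1) => (z : ℕ)) k = ENNReal.ofReal
      (lapWeight m (Real.exp (-1 / s)) k /
        (2 * ∑ v ∈ Finset.range (m + 1), Real.exp (-1 / s) ^ v)) := by
  set r := Real.exp (-1 / s) with hr
  have hr0 : 0 < r := Real.exp_pos _
  have he : 0 < Real.exp (-1 / (2 * s)) := Real.exp_pos _
  have hG : 0 < 2 * ∑ v ∈ Finset.range (m + 1), r ^ v := by
    refine mul_pos two_pos (Finset.sum_pos (fun v _ => by positivity) (by simp))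
  have hsum : ∑' z, laplaceWeight (2 * m + 1) s z = ENNReal.ofReal
      (Real.exp (-1 / (2 * s)) * (2 * ∑ v ∈ Finset.range (m + 1), r ^ v)) := by
    rw [tsum_fintype]
    simp only [laplaceWeight_eq, ← hr]
    rw [← ENNReal.ofReal_sum_of_nonneg fun z _ => mul_nonneg he.le (lapWeight_nonneg hr0.le _),
      ← Finset.mul_sum, ← sum_lapWeight,
      Fin.sum_univ_eq_sum_range (fun k => lapWeight m r k) (2 * m + 1 + 1)]
  rw [PMF.map_apply]
  by_cases hk : k < 2 * m + 1 + 1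
  · rw [tsum_eq_single (⟨k, hk⟩ : Fin (2 * m + 1 + 1))]
    · rw [if_pos rfl, truncLaplace, PMF.normalize_apply, hsum, laplaceWeight_eq,
        ← ENNReal.ofReal_inv_of_pos (by positivity), ← ENNReal.ofReal_mul
        (mul_nonneg he.le (lapWeight_nonneg hr0.le _))]
      congr 1
      field_simp
    · intro z hz
      rw [if_neg]
      rintro rfl
      exact hz rfl
  · rw [ENNReal.tsum_eq_zero.2, lapWeight, if_neg (by omega), if_neg (by omega)]
    · simp
    · intro z
      rw [if_neg]
      have := z.2
      omega

theorem map_count_binaryRandomizer (m : ℕ) (s : ℝ) (p : ℝ≥0) (hp : p ≤ 1) (x : Bool) (k : ℕ) :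
    (binaryRandomizer (2 * m + 1) s p hp x).map (List.count true) k = ENNReal.ofReal
      ((userPoly m (Real.exp (-1 / s))
        (p / (2 * ∑ v ∈ Finset.range (m + 1), Real.exp (-1 / s) ^ v)) (1 - p)
        (bitIndex x)).coeff k) := by
  have hr0 : 0 < Real.exp (-1 / s) := Real.exp_pos _
  have hG : 0 < 2 * ∑ v ∈ Finset.range (m + 1), Real.exp (-1 / s) ^ v :=
    mul_pos two_pos (Finset.sum_pos (fun v _ => by positivity) (by simp))
  have hp1 : (p : ℝ) ≤ 1 := by exact_mod_cast hp
  have hw := lapWeight_nonneg (m := m) hr0.le k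
  rw [binaryRandomizer, PMF.map_bind, PMF.bind_apply, tsum_bool, coeff_userPoly hr0.ne']
  simp only [Bool.false_eq_true, if_false, if_true]
  have h1 : ((truncLaplace (2 * m + 1) s).map (fun z : Fin (2 * m + 1 + 1) =>
      bits (z : ℕ) (2 * m + 1 - (z : ℕ)))).map (List.count true) =
      (truncLaplace (2 * m + 1) s).map fun z : Fin (2 * m + 1 + 1) => (z : ℕ) := by
    rw [PMF.map_comp]
    congr 1
    funext z
    exact count_bits _ _
  rw [h1, truncLaplace_map_val, PMF.pure_map, PMF.pure_apply]
  have h2 : (List.count true (if x then bits ((2 * m + 1 + 1) / 2) ((2 * m + 1 - 1) / 2)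
      else bits ((2 * m + 1 - 1) / 2) ((2 * m + 1 + 1) / 2))) = m + bitIndex x := by
    cases x
    · simp only [Bool.false_eq_true, if_false, count_bits, bitIndex]; omega
    · simp only [if_true, count_bits, bitIndex]; omega
  rw [h2, coin, PMF.ofFintype_apply, PMF.ofFintype_apply]
  simp only [Bool.false_eq_true, if_false, if_true]
  rw [ENNReal.ofReal_add (by split_ifs <;> linarith) (by positivity)]
  congr 1
  · split_ifs
    · rw [mul_one, ENNReal.ofReal_sub _ p.coe_nonneg]; simp
    · simp
  · rw [div_mul_eq_mul_div, mul_div_assoc, ENNReal.ofReal_mul p.coe_nonneg]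
    simp

theorem binarySummation_sends (n m : ℕ) (s : ℝ) (p : ℝ≥0) (hp : p ≤ 1) :
    (binarySummation n (2 * m + 1) s p hp).Sends (2 * m + 1) := by
  intro x l hl
  simp only [binarySummation, binaryRandomizer, PMF.mem_support_bind_iff] at hl
  obtain ⟨a, -, hl⟩ := hl
  cases a
  · simp only [Bool.false_eq_true, if_false, PMF.mem_support_pure_iff] at hl
    rw [hl]
    split_ifs <;> rw [length_bits] <;> omega
  · simp only [if_true, PMF.mem_support_map_iff] at hl
    obtain ⟨z, -, rfl⟩ := hl
    have := z.2
    rw [length_bits]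
    omega

theorem countPMF_binaryRandomizer {n m : ℕ} {s : ℝ} {p : ℝ≥0} (hp : p ≤ 1) (x : Fin n → Bool)
    (hr : r = Real.exp (-1 / s))
    (hκ : κ = p / (2 * ∑ v ∈ Finset.range (m + 1), r ^ v)) (hα : α = 1 - p) (k : ℕ) :
    countPMF (binaryRandomizer (2 * m + 1) s p hp) (List.ofFn x) k =
      ENNReal.ofReal ((∏ j, userPoly m r κ α (bitIndex (x j))).coeff k) := by
  have hp1 : (p : ℝ) ≤ 1 := by exact_mod_cast hp
  have hr0 : 0 < r := hr ▸ Real.exp_pos _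
  have hκ0 : 0 ≤ κ := by rw [hκ]; positivity
  rw [countPMF_apply (P := fun b => userPoly m r κ α (bitIndex b))]
  · rw [List.map_ofFn, List.prod_ofFn]
    rfl
  · exact fun b => zero_le_userPoly hr0.le hκ0 (by linarith) _
  · intro b k
    rw [map_count_binaryRandomizer, ← hr, ← hκ, ← hα]

theorem binarySummation_isShuffledDP {n m k₀ U h : ℕ} {ε τ s : ℝ} {p : ℝ≥0} (hp : p ≤ 1)
    (hr : r = Real.exp (-1 / s))
    (hκ : κ = p / (2 * ∑ v ∈ Finset.range (m + 1), r ^ v)) (hα : α = 1 - p)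
    (hg : GoodParams (n - 1) m k₀ U h r κ α (ε / 8) τ) (hε1 : ε ≤ 1) (hτ : τ ≤ ε / 16) :
    (binarySummation n (2 * m + 1) s p hp).IsShuffledDP n ε := by
  refine isShuffledDP_of_countPMF_le (binarySummation_sends n m s p hp) fun x x' hx k => ?_
  have hε0 : 0 < ε := by linarith [hg.δ_pos]
  change countPMF (binaryRandomizer (2 * m + 1) s p hp) (List.ofFn x) k ≤ ENNReal.ofReal _ *
    countPMF (binaryRandomizer (2 * m + 1) s p hp) (List.ofFn x') k
  rw [countPMF_binaryRandomizer hp x hr hκ hα, countPMF_binaryRandomizer hp x' hr hκ hα,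
    ← ENNReal.ofReal_mul (Real.exp_pos _).le]
  refine ENNReal.ofReal_le_ofReal ?_
  have h1 := prod_userPoly_le hg hε1 hτ hx k
  rw [coeff_C_mul] at h1
  refine h1.trans ?_
  have h2 : 0 ≤ᶜ ∏ j, userPoly m r κ α (bitIndex (x' j)) := by
    have hP : ∀ b, 0 ≤ᶜ userPoly m r κ α b :=
      zero_le_userPoly hg.r_pos.le hg.κ_nonneg hg.α_pos.le
    obtain ⟨n₀, n₁, -, h2⟩ := prod_userPoly_eq (m := m) (r := r) (κ := κ) (α := α) Finset.univ x'
    rw [h2]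
    exact CoeffLE.zero_le_mul (CoeffLE.zero_le_pow (hP _) _) (CoeffLE.zero_le_pow (hP _) _)
  have h3 : 0 ≤ (∏ j, userPoly m r κ α (bitIndex (x' j))).coeff k := by simpa using h2 k
  have h4 := Real.add_one_le_exp ε
  gcongr
  linarith

end ShuffledDP

/-! ### Moments of the count and the expected error. -/

namespace ShuffledDP

open Polynomial

variable {m : ℕ} {r κ α : ℝ}

/-- Multiply the coefficient of index `c` by `c - a`. -/
noncomputable def centered (a : ℝ) (F : ℝ[X]) : ℝ[X] := X * derivative F - C a * F

theorem coeff_centered (a : ℝ) (F : ℝ[X]) (c : ℕ) :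
    (centered a F).coeff c = ((c : ℝ) - a) * F.coeff c := by
  rw [centered, coeff_sub, coeff_C_mul]
  cases c with
  | zero => simp
  | succ c => rw [coeff_X_mul, coeff_derivative]; push_cast; ring

theorem centered_mul (a b : ℝ) (F G : ℝ[X]) :
    centered (a + b) (F * G) = centered a F * G + F * centered b G := by
  simp only [centered, derivative_mul, C_add]; ring

theorem centered_add (a : ℝ) (F G : ℝ[X]) :
    centered a (F + G) = centered a F + centered a G := by
  simp only [centered, derivative_add]; ring

/-- Evaluation at `1` is expectation, and `centered` obeys a Leibniz rule. The cross terms of the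
second moment are products of biases, hence the square of `card * q`. -/
theorem moments_prod_le {ι : Type*} (s : Finset ι) {P : ι → ℝ[X]} {a : ι → ℝ} {q v : ℝ}
    (hq : 0 ≤ q) (h0 : ∀ j, (P j).eval 1 = 1) (h1 : ∀ j, |(centered (a j) (P j)).eval 1| ≤ q)
    (h2 : ∀ j, (centered (a j) (centered (a j) (P j))).eval 1 ≤ v) :
    (∏ j ∈ s, P j).eval 1 = 1 ∧ |(centered (∑ j ∈ s, a j) (∏ j ∈ s, P j)).eval 1| ≤ s.card * q ∧
    (centered (∑ j ∈ s, a j) (centered (∑ j ∈ s, a j) (∏ j ∈ s, P j))).eval 1 ≤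
      s.card * v + (s.card * q) ^ 2 := by
  classical
  induction s using Finset.induction_on with
  | empty => simp [centered]
  | insert i s hi ih =>
    obtain ⟨i0, i1, i2⟩ := ih
    rw [Finset.prod_insert hi, Finset.sum_insert hi, Finset.card_insert_of_notMem hi]
    have hi1 := h1 i
    have hi2 := h2 i
    refine ⟨by rw [eval_mul, h0, i0, one_mul], ?_, ?_⟩
    · rw [centered_mul, eval_add, eval_mul, eval_mul, h0, i0, mul_one, one_mul]
      refine (abs_add_le _ _).trans ?_
      push_cast
      linarith
    · rw [centered_mul, centered_add, centered_mul, centered_mul]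
      simp only [eval_add, eval_mul, h0, i0, mul_one, one_mul]
      set x := (centered (a i) (P i)).eval 1
      set y := (centered (∑ j ∈ s, a j) (∏ j ∈ s, P j)).eval 1
      have hxy : x * y ≤ q * (s.card * q) :=
        (le_abs_self _).trans (by rw [abs_mul]; gcongr)
      push_cast
      nlinarith [mul_nonneg hq hq]

theorem sum_lapWeight_mul (m : ℕ) (r : ℝ) (f : ℝ → ℝ) :
    ∑ k ∈ Finset.range (2 * m + 2), lapWeight m r k * f k =
    ∑ v ∈ Finset.range (m + 1), r ^ v * (f ((m : ℝ) - v) + f ((m : ℝ) + 1 + v)) := by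
  rw [show 2 * m + 2 = (m + 1) + (m + 1) by ring, Finset.sum_range_add]
  simp only [mul_add, Finset.sum_add_distrib]
  congr 1
  · rw [← Finset.sum_range_reflect]
    refine Finset.sum_congr rfl fun k hk => ?_
    have := Finset.mem_range.1 hk
    rw [lapWeight, if_pos (by omega), show m + 1 - 1 - k = m - k by omega,
      Nat.cast_sub (by omega), show m - (m - k) = k by omega]
  · refine Finset.sum_congr rfl fun k hk => ?_
    have := Finset.mem_range.1 hk
    rw [lapWeight, if_neg (by omega), if_pos (by omega), show m + 1 + k - (m + 1) = k by omega]
    push_cast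
    rfl

theorem eval_one_eq_sum {F : ℝ[X]} {N : ℕ} (h : ∀ c, N ≤ c → F.coeff c = 0) :
    F.eval 1 = ∑ c ∈ Finset.range N, F.coeff c := by
  rw [eval_eq_sum, sum_def]
  simp only [one_pow, mul_one]
  refine Finset.sum_subset ?_ ?_
  · intro c hc
    rw [Finset.mem_range]
    by_contra hcon
    exact (mem_support_iff.1 hc) (h c (by omega))
  · intro c _ hc
    simpa using hc

theorem coeff_userPoly_eq_zero (hr : r ≠ 0) {b : ℕ} (hb : b ≤ 1) {c : ℕ} (hc : 2 * m + 2 ≤ c) :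
    (userPoly m r κ α b).coeff c = 0 := by
  rw [coeff_userPoly hr, lapWeight, if_neg (by omega), if_neg (by omega), if_neg (by omega)]
  simp

theorem sum_coeff_userPoly_mul (hr : r ≠ 0) {b : ℕ} (hb : b ≤ 1) (f : ℝ → ℝ) :
    ∑ c ∈ Finset.range (2 * m + 2), f c * (userPoly m r κ α b).coeff c =
      α * f ((m : ℝ) + b) +
        κ * ∑ v ∈ Finset.range (m + 1), r ^ v * (f ((m : ℝ) - v) + f ((m : ℝ) + 1 + v)) := by
  rw [← sum_lapWeight_mul, Finset.mul_sum]
  simp only [coeff_userPoly hr, mul_add, Finset.sum_add_distrib]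
  congr 1
  · simp only [mul_ite, mul_zero]
    rw [Finset.sum_ite_eq', if_pos (Finset.mem_range.2 (by omega))]
    push_cast
    ring
  · exact Finset.sum_congr rfl fun c _ => by ring

/-- The noise values `m - v` and `m + 1 + v` pair up: their deviations from `m + b` add up to `±1`,
which bounds the bias, and their squares add up to at most `4 * (v + 2).choose 2`, whose geometric
series is `4 / (1 - r)^3`. -/
theorem moments_userPoly (hr : 0 < r) (hr1 : r < 1) (hκ : 0 ≤ κ) {b : ℕ} (hb : b ≤ 1)
    (hα : α + κ * (2 * ∑ v ∈ Finset.range (m + 1), r ^ v) = 1) :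
    (userPoly m r κ α b).eval 1 = 1 ∧
    |(centered ((m : ℝ) + b) (userPoly m r κ α b)).eval 1| ≤ κ / (1 - r) ∧
    (centered ((m : ℝ) + b) (centered ((m : ℝ) + b) (userPoly m r κ α b))).eval 1 ≤
      4 * κ / (1 - r) ^ 3 := by
  have hr' : 0 < 1 - r := by linarith
  have hnorm : ‖r‖ < 1 := by rw [Real.norm_of_nonneg hr.le]; exact hr1
  have h0 : ∀ c, 2 * m + 2 ≤ c → (userPoly m r κ α b).coeff c = 0 := fun c hc =>
    coeff_userPoly_eq_zero hr.ne' hb hc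
  have h1 : ∀ c, 2 * m + 2 ≤ c →
      (centered ((m : ℝ) + b) (userPoly m r κ α b)).coeff c = 0 := fun c hc => by
    rw [coeff_centered, h0 c hc, mul_zero]
  have h2 : ∀ c, 2 * m + 2 ≤ c →
      (centered ((m : ℝ) + b) (centered ((m : ℝ) + b) (userPoly m r κ α b))).coeff c = 0 :=
    fun c hc => by rw [coeff_centered, h1 c hc, mul_zero]
  rw [eval_one_eq_sum h0, eval_one_eq_sum h1, eval_one_eq_sum h2]
  simp only [coeff_centered, ← mul_assoc]
  have e0 := sum_coeff_userPoly_mul (m := m) (κ := κ) (α := α) hr.ne' hb fun _ => 1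
  have e1 := sum_coeff_userPoly_mul (m := m) (κ := κ) (α := α) hr.ne' hb fun c => c - (m + b)
  have e2 := sum_coeff_userPoly_mul (m := m) (κ := κ) (α := α) hr.ne' hb
    fun c => (c - (m + b)) * (c - (m + b))
  simp only [one_mul, mul_one] at e0
  rw [e0, e1, e2]
  have hb' : (b : ℝ) = 0 ∨ (b : ℝ) = 1 := by
    obtain rfl | rfl : b = 0 ∨ b = 1 := by omega
    · simp
    · simp
  refine ⟨?_, ?_, ?_⟩
  · rw [← Finset.sum_mul]; linarith
  · have hsum : ∑ v ∈ Finset.range (m + 1),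
        r ^ v * ((m : ℝ) - v - (m + b) + ((m : ℝ) + 1 + v - (m + b))) =
        (1 - 2 * b) * ∑ v ∈ Finset.range (m + 1), r ^ v := by
      rw [Finset.mul_sum]
      exact Finset.sum_congr rfl fun v _ => by ring
    have hG : ∑ v ∈ Finset.range (m + 1), r ^ v ≤ (1 - r)⁻¹ :=
      sum_le_hasSum _ (fun v _ => by positivity) (hasSum_geometric_of_norm_lt_one hnorm)
    have hG0 : 0 ≤ ∑ v ∈ Finset.range (m + 1), r ^ v := Finset.sum_nonneg fun v _ => by positivity
    rw [hsum, sub_self, mul_zero, zero_add, abs_mul, abs_mul, abs_of_nonneg hκ, abs_of_nonneg hG0,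
      div_eq_mul_inv]
    have : |1 - 2 * (b : ℝ)| = 1 := by
      rcases hb' with h | h <;> rw [h] <;> norm_num
    rw [this, one_mul]
    gcongr
  · have hsum : ∑ v ∈ Finset.range (m + 1), r ^ v * (((m : ℝ) - v - (m + b)) * ((m : ℝ) - v - (m + b))
        + ((m : ℝ) + 1 + v - (m + b)) * ((m : ℝ) + 1 + v - (m + b))) ≤
        4 * ∑ v ∈ Finset.range (m + 1), ((v + 2).choose 2 : ℝ) * r ^ v := by
      rw [Finset.mul_sum]
      refine Finset.sum_le_sum fun v _ => ?_
      have hch : ((v + 2).choose 2 : ℝ) * 2 = ((v : ℝ) + 2) * (v + 1) := by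
        have := Nat.choose_two_right (v + 2)
        rw [Nat.cast_choose_two]; push_cast; ring
      have hv : (0 : ℝ) ≤ v := by positivity
      have : ((m : ℝ) - v - (m + b)) * ((m : ℝ) - v - (m + b))
        + ((m : ℝ) + 1 + v - (m + b)) * ((m : ℝ) + 1 + v - (m + b)) ≤
          4 * ((v + 2).choose 2 : ℝ) := by
        rcases hb' with h | h <;> rw [h] <;> nlinarith
      calc _ ≤ r ^ v * (4 * ((v + 2).choose 2 : ℝ)) := by gcongr
        _ = _ := by ring
    have hS : ∑ v ∈ Finset.range (m + 1), ((v + 2).choose 2 : ℝ) * r ^ v ≤ 1 / (1 - r) ^ 3 :=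
      sum_le_hasSum _ (fun v _ => by positivity) (hasSum_choose_mul_geometric_of_norm_lt_one 2 hnorm)
    rw [sub_self, mul_zero, mul_zero, zero_add]
    calc _ ≤ κ * (4 * (1 / (1 - r) ^ 3)) := by gcongr; linarith
      _ = _ := by ring

theorem binaryAnalyzer_eq (n : ℕ) {m : ℕ} (l : List Bool) (h : l.length = (2 * m + 1) * n) :
    binaryAnalyzer n l = (l.count true : ℝ) - m * n := by
  have key : ∀ l : List Bool, (l.map fun y => (if y then (1 : ℝ) else 0) - 1 / 2).sum =
      l.count true - (l.length : ℝ) / 2 := by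
    intro l
    induction l with
    | nil => simp
    | cons y l ih =>
      rw [List.map_cons, List.sum_cons, ih]
      cases y
      · simp; ring
      · simp; ring
  rw [binaryAnalyzer, key, h]
  push_cast
  ring

theorem expectedError_le {n m : ℕ} {s : ℝ} {p : ℝ≥0} (hp : p ≤ 1) (hs : 0 < s)
    (hr : r = Real.exp (-1 / s))
    (hκ : κ = p / (2 * ∑ v ∈ Finset.range (m + 1), r ^ v)) (x : Fin n → Bool) {t : ℝ} (ht : 0 < t) :
    (binarySummation n (2 * m + 1) s p hp).expectedError x ≤ ENNReal.ofReal
      (((n * (4 * κ / (1 - r) ^ 3) + (n * (κ / (1 - r))) ^ 2) / t + t) / 2) := by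
  have hp1 : (p : ℝ) ≤ 1 := by exact_mod_cast hp
  have hr0 : 0 < r := hr ▸ Real.exp_pos _
  have hr1 : r < 1 := by
    rw [hr, Real.exp_lt_one_iff]
    exact div_neg_of_neg_of_pos (by norm_num) hs
  have hG : 0 < 2 * ∑ v ∈ Finset.range (m + 1), r ^ v :=
    mul_pos two_pos (Finset.sum_pos (fun v _ => by positivity) (by simp))
  have hκ0 : 0 ≤ κ := by rw [hκ]; positivity
  obtain ⟨α, hα⟩ : ∃ α : ℝ, α = 1 - p := ⟨_, rfl⟩
  have hα0 : 0 ≤ α := by linarith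
  have hακ : α + κ * (2 * ∑ v ∈ Finset.range (m + 1), r ^ v) = 1 := by
    rw [hκ, hα, div_mul_cancel₀ _ hG.ne']; ring
  have hbit : ∀ b, bitIndex b ≤ 1 := by decide
  set F := ∏ j, userPoly m r κ α (bitIndex (x j)) with hF
  set a : ℝ := ∑ j, ((m : ℝ) + bitIndex (x j)) with ha
  have ha' : a = m * n + bitSum x := by
    rw [ha, Finset.sum_add_distrib, bitSum]
    simp only [Finset.sum_const, Finset.card_univ, Fintype.card_fin, nsmul_eq_mul, bitIndex]
    push_cast
    ring
  obtain ⟨m0, -, m2⟩ := moments_prod_le (Finset.univ : Finset (Fin n))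
    (P := fun j => userPoly m r κ α (bitIndex (x j))) (a := fun j => (m : ℝ) + bitIndex (x j))
    (q := κ / (1 - r)) (v := 4 * κ / (1 - r) ^ 3) (div_nonneg hκ0 (by linarith))
    (fun j => (moments_userPoly hr0 hr1 hκ0 (hbit _) hακ).1)
    (fun j => (moments_userPoly hr0 hr1 hκ0 (hbit _) hακ).2.1)
    (fun j => (moments_userPoly hr0 hr1 hκ0 (hbit _) hακ).2.2)
  rw [← hF] at m0
  rw [← hF, ← ha, Finset.card_univ, Fintype.card_fin] at m2
  have hF0 : ∀ c, 0 ≤ F.coeff c := by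
    have hP : ∀ b, 0 ≤ᶜ userPoly m r κ α b := zero_le_userPoly hr0.le hκ0 hα0
    obtain ⟨n₀, n₁, -, h2⟩ := prod_userPoly_eq (m := m) (r := r) (κ := κ) (α := α) Finset.univ x
    intro c
    rw [hF, h2]
    simpa using CoeffLE.zero_le_mul (CoeffLE.zero_le_pow (hP 0) n₀) (CoeffLE.zero_le_pow (hP 1) n₁) c
  set N := F.natDegree + 1 with hN
  have hFN : ∀ c, N ≤ c → F.coeff c = 0 := fun c hc => coeff_eq_zero_of_natDegree_lt (by omega)
  rw [eval_one_eq_sum hFN] at m0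
  rw [eval_one_eq_sum (N := N) fun c hc => by
    rw [coeff_centered, coeff_centered, hFN c hc, mul_zero, mul_zero]] at m2
  simp only [coeff_centered] at m2
  have herr : (binarySummation n (2 * m + 1) s p hp).expectedError x =
      ∑' c, ENNReal.ofReal (F.coeff c) * ENNReal.ofReal |(c : ℝ) - a| := by
    have h1 : ∀ c, ENNReal.ofReal (F.coeff c) =
        ((binarySummation n (2 * m + 1) s p hp).view x).map (List.count true) c := fun c => by
      rw [map_count_view]
      exact (countPMF_binaryRandomizer hp x hr hκ hα c).symm
    simp only [h1]
    rw [← tsum_mul_comp _ _ fun c : ℕ => ENNReal.ofReal |(c : ℝ) - a|, Protocol.expectedError]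
    refine tsum_congr fun v => ?_
    by_cases hv : v ∈ ((binarySummation n (2 * m + 1) s p hp).view x).support
    · have hlen := length_of_mem_support_view (binarySummation_sends n m s p hp) hv
      congr 2
      change |binaryAnalyzer n v - _| = _
      rw [binaryAnalyzer_eq n v hlen, ha']
      congr 1
      ring
    · rw [PMF.mem_support_iff, not_not] at hv
      rw [hv, zero_mul, zero_mul]
  rw [herr, tsum_eq_sum (s := Finset.range N)]
  · simp only [← ENNReal.ofReal_mul (hF0 _)]
    rw [← ENNReal.ofReal_sum_of_nonneg fun c _ => mul_nonneg (hF0 c) (abs_nonneg _)]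
    refine ENNReal.ofReal_le_ofReal ?_
    have hpt : ∀ c ∈ Finset.range N, F.coeff c * |(c : ℝ) - a| ≤
        (((c : ℝ) - a) * (((c : ℝ) - a) * F.coeff c)) * (1 / (2 * t)) + F.coeff c * (t / 2) := by
      intro c _
      -- The inequality `2 |u| t ≤ u² + t²` replaces Cauchy–Schwarz. The scale `t` is later taken to
      -- be the target error.
      have h1 : |(c : ℝ) - a| ≤ ((c : ℝ) - a) * ((c : ℝ) - a) * (1 / (2 * t)) + t / 2 := by
        have h2 : 0 ≤ (|(c : ℝ) - a| - t) ^ 2 := sq_nonneg _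
        have h3 : |(c : ℝ) - a| ^ 2 = ((c : ℝ) - a) ^ 2 := sq_abs _
        have e : ((c : ℝ) - a) * ((c : ℝ) - a) * (1 / (2 * t)) + t / 2 - |(c : ℝ) - a| =
            (|(c : ℝ) - a| - t) ^ 2 * (1 / (2 * t)) := by
          field_simp
          rw [← h3]
          ring
        have : 0 ≤ (|(c : ℝ) - a| - t) ^ 2 * (1 / (2 * t)) := by positivity
        linarith
      calc F.coeff c * |(c : ℝ) - a|
          ≤ F.coeff c * (((c : ℝ) - a) * ((c : ℝ) - a) * (1 / (2 * t)) + t / 2) := by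
            gcongr; exact hF0 c
        _ = _ := by ring
    refine (Finset.sum_le_sum hpt).trans ?_
    rw [Finset.sum_add_distrib, ← Finset.sum_mul, ← Finset.sum_mul, m0]
    calc _ ≤ (n * (4 * κ / (1 - r) ^ 3) + (n * (κ / (1 - r))) ^ 2) * (1 / (2 * t)) + 1 * (t / 2) := by
          gcongr
      _ = _ := by field_simp
  · intro c hc
    rw [hFN c (by simpa using hc), ENNReal.ofReal_zero, zero_mul]

end ShuffledDP

/-! ### Choice of the parameters. -/

namespace ShuffledDP

open Filter

theorem exp_half_le_one_add {x : ℝ} (h0 : 0 ≤ x) (h1 : x ≤ 1) : Real.exp (x / 2) ≤ 1 + x := by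
  have h := Real.exp_bound_div_one_sub_of_interval (x := x / 2) (by linarith) (by linarith)
  refine h.trans ?_
  rw [div_le_iff₀ (by linarith)]
  nlinarith

theorem exp_mul_half_le_pow {x : ℝ} (h0 : 0 ≤ x) (h1 : x ≤ 1) (k : ℕ) :
    Real.exp (k * (x / 2)) ≤ (1 + x) ^ k := by
  rw [Real.exp_nat_mul]
  exact pow_le_pow_left₀ (Real.exp_pos _).le (exp_half_le_one_add h0 h1) k

theorem eventually_log_le : ∃ n₁ : ℕ, ∀ n : ℕ, n₁ ≤ n → 10 ≤ Real.log n ∧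
    16 * (40960 * Real.log n) ^ 4 ≤ ((n : ℝ) ^ ((1 : ℝ) / 3)) ^ 2 := by
  have h1 : ∀ᶠ x : ℝ in atTop, 10 ≤ Real.log x := Real.tendsto_log_atTop.eventually_ge_atTop 10
  have h2 := (isLittleO_log_rpow_atTop (r := 1 / 6) (by norm_num)).bound
    (c := 1 / (2 * 40960)) (by norm_num)
  have h3 := tendsto_natCast_atTop_atTop.eventually ((h1.and h2).and (eventually_ge_atTop 1))
  obtain ⟨n₁, hn₁⟩ := eventually_atTop.1 h3
  refine ⟨n₁, fun n hn => ?_⟩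
  obtain ⟨⟨h4, h5⟩, h6⟩ := hn₁ n hn
  have hn0 : (0 : ℝ) ≤ n := by positivity
  refine ⟨h4, ?_⟩
  rw [Real.norm_of_nonneg (by linarith), Real.norm_of_nonneg (by positivity)] at h5
  have h7 : 40960 * Real.log n ≤ (n : ℝ) ^ ((1 : ℝ) / 6) / 2 := by linarith
  have h8 : ((n : ℝ) ^ ((1 : ℝ) / 6)) ^ 2 = (n : ℝ) ^ ((1 : ℝ) / 3) := by
    rw [← Real.rpow_natCast, ← Real.rpow_mul hn0]
    norm_num
  calc 16 * (40960 * Real.log n) ^ 4 ≤ 16 * ((n : ℝ) ^ ((1 : ℝ) / 6) / 2) ^ 4 := by gcongr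
    _ = (((n : ℝ) ^ ((1 : ℝ) / 6)) ^ 2) ^ 2 := by ring
    _ = _ := by rw [h8]

theorem half_le_one_sub_exp {x : ℝ} (h0 : 0 ≤ x) (h1 : x ≤ 1) : x / 2 ≤ 1 - Real.exp (-x) := by
  have h2 := Real.add_one_le_exp x
  rw [Real.exp_neg]
  have h3 : (Real.exp x)⁻¹ ≤ (1 + x)⁻¹ := inv_anti₀ (by linarith) (by linarith)
  have h4 : (1 + x)⁻¹ ≤ 1 - x / 2 := by
    rw [inv_le_iff_one_le_mul₀ (by linarith)]
    nlinarith
  linarith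

/-- About `n/8` users suffice: `N κ ≥ 4ℓ` with `ℓ = log(1/ε)`, and `(1 + κ)^(N-1) ≥ e^(2ℓ) = ε⁻²`
outweighs the factor `ε/8`. -/
theorem many_params {n m k₀ N : ℕ} {ε L ℓ r κ : ℝ} (hL : 10 ≤ L) (hε0 : 0 < ε) (hε1 : ε ≤ 1 / 10)
    (hLn : 16 * (40960 * L) ≤ n) (hn0 : (0 : ℝ) < n) (hn1 : 1 ≤ n)
    (hexpℓ : Real.exp ℓ = 1 / ε) (hℓL : ℓ ≤ L) (hℓ2 : 9 / 4 ≤ ℓ)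
    (hr0 : 0 < r) (hrge : 1 - ε / 32 ≤ r) (hκ0 : 0 < κ) (hnκ : n * κ = 40 * ℓ)
    (hk₀2 : (k₀ : ℝ) ≤ 21 * L) (hmε : 200 * L ≤ m * ε) (hN : n - 1 ≤ 8 * N) :
    k₀ ≤ N ∧ 1 ≤ N * κ ∧ (k₀ : ℝ) ≤ ε / 8 * r * m * κ * (N - k₀) ∧
      1 ≤ ε / 8 * r * N * κ * (1 + κ) ^ (N - 1) := by
  have hN' : (n : ℝ) ≤ 8 * N + 1 := by exact_mod_cast (by omega : n ≤ 8 * N + 1)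
  have hN1 : (n : ℝ) / 10 ≤ N - 1 := by linarith
  have hN0 : 1 ≤ N := by
    have : (1 : ℝ) ≤ N := by linarith
    exact_mod_cast this
  have hNk : (n : ℝ) / 20 ≤ N - k₀ := by linarith
  have hNκ : 4 * ℓ ≤ N * κ := by
    calc 4 * ℓ = n / 10 * κ := by linarith
      _ ≤ N * κ := by gcongr; linarith
  have hr2 : 1 / 2 ≤ r := by linarith
  refine ⟨?_, by linarith, ?_, ?_⟩
  · have : (k₀ : ℝ) ≤ N := by linarith
    exact_mod_cast this
  · calc (k₀ : ℝ) ≤ 21 * L := hk₀2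
      _ ≤ 25 * L * ℓ := by nlinarith
      _ = 200 * L / 8 * (1 / 2) * (n * κ) / 20 := by rw [hnκ]; ring
      _ ≤ m * ε / 8 * r * (n * κ) / 20 := by gcongr
      _ = ε / 8 * r * m * κ * (n / 20) := by ring
      _ ≤ _ := by gcongr
  · have h1 : 1 / ε ^ 2 ≤ (1 + κ) ^ (N - 1) := by
      have hκ1 : κ ≤ 1 := by
        refine le_of_mul_le_mul_left ?_ hn0
        linarith
      refine le_trans ?_ (exp_mul_half_le_pow hκ0.le hκ1 (N - 1))
      have h2 : Real.exp (2 * ℓ) = 1 / ε ^ 2 := by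
        rw [two_mul, Real.exp_add, hexpℓ]; field_simp
      rw [← h2]
      apply Real.exp_le_exp.2
      rw [Nat.cast_sub hN0, Nat.cast_one]
      calc 2 * ℓ = n / 10 * (κ / 2) := by linarith
        _ ≤ _ := by gcongr
    calc 1 ≤ 9 / 16 * (1 / ε) := by
          rw [mul_one_div, le_div_iff₀ hε0]; linarith
      _ = ε / 8 * (1 / 2) * (4 * (9 / 4)) * (1 / ε ^ 2) := by field_simp; norm_num
      _ ≤ ε / 8 * r * (4 * ℓ) * (1 + κ) ^ (N - 1) := by gcongr
      _ ≤ ε / 8 * r * (N * κ) * (1 + κ) ^ (N - 1) := by gcongr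
      _ = _ := by ring

theorem goodParams_of {n m k₀ U : ℕ} {ε y L ℓ r κ p : ℝ} (hy : y ^ 3 = n)
    (hL : 10 ≤ L) (hy1 : 1 ≤ y) (hε : 1 < ε * y ^ 2) (hε0 : 0 < ε) (hε1 : ε ≤ 1 / 10)
    (hLn : 16 * (40960 * L) ≤ n) (hn0 : (0 : ℝ) < n) (hn1 : 1 ≤ n) (hεn : 1 / ε ≤ n)
    (hexpL : Real.exp L = n) (hexpℓ : Real.exp ℓ = 1 / ε) (hℓL : ℓ ≤ L) (hℓ2 : 9 / 4 ≤ ℓ)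
    (hr0 : 0 < r) (hr1 : r ≤ 1) (hrge : 1 - ε / 32 ≤ r) (hκ0 : 0 < κ) (hnκ : n * κ = 40 * ℓ)
    (hκε : 1024 * κ / ε ≤ 40960 * L / y) (hLy4 : (40960 * L / y) ^ 4 ≤ ε / 16)
    (hp0 : 0 ≤ p) (hp8 : p ≤ 1 / 8) (hk₀1 : 20 * L ≤ k₀) (hk₀2 : (k₀ : ℝ) ≤ 21 * L)
    (hm1 : 200 * L / ε ≤ m) (hm2 : (m : ℝ) ≤ 200 * L / ε + 1)
    (hU1 : (U : ℝ) ≤ k₀ / (ε / 8)) (hU2 : k₀ / (ε / 8) - 1 ≤ U) :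
    GoodParams (n - 1) m k₀ U 4 r κ (1 - p) (ε / 8) (ε / 16) := by
  have hmε : 200 * L ≤ m * ε := by rwa [div_le_iff₀ hε0] at hm1
  have hpow : ∀ k : ℕ, Real.exp (k * (ε / 64)) ≤ (1 + ε / 8 / 4) ^ k := fun k => by
    have := exp_mul_half_le_pow (x := ε / 8 / 4) (by linarith) (by linarith) k
    convert this using 3
    ring
  refine ⟨by positivity, by linarith, hκ0.le, hr0, hr1, by linarith, by linarith [hp0],
    by nlinarith, ?_, ?_, ?_, ?_, ?_, ?_, ?_, ?_⟩
  · have : (20 : ℝ) ≤ k₀ := by linarith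
    exact_mod_cast this
  · refine le_trans ?_ (hpow m)
    -- Here `m ε ≥ 200 L` and `200/64 > 3`.
    have h1 : (n : ℝ) ^ 3 ≤ Real.exp (m * (ε / 64)) := by
      rw [← hexpL, ← Real.exp_nat_mul]
      apply Real.exp_le_exp.2
      push_cast
      linarith
    refine le_trans ?_ h1
    have h2 : 200 * L / ε ≤ 200 * n * n := by
      rw [mul_div_assoc, div_eq_mul_one_div, mul_assoc]
      gcongr
      linarith
    have h3 : (5000 : ℝ) ≤ n := by linarith
    nlinarith [mul_nonneg hn0.le hn0.le]
  · have h1 : (U : ℝ) ≤ m := by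
      refine hU1.trans (le_trans ?_ hm1)
      rw [div_div_eq_mul_div]
      exact div_le_div_of_nonneg_right (by linarith) hε0.le
    exact_mod_cast h1
  · rwa [le_div_iff₀ (by positivity), mul_comm] at hU1
  · have h1 : (n : ℝ) ^ 2 ≤ (1 + ε / 8 / 4) ^ U := by
      refine le_trans ?_ (hpow U)
      rw [← hexpL, ← Real.exp_nat_mul]
      apply Real.exp_le_exp.2
      have h2 : (k₀ / (ε / 8) - 1) * (ε / 64) ≤ U * (ε / 64) := by gcongr
      have h3 : (k₀ / (ε / 8) - 1) * (ε / 64) = k₀ / 8 - ε / 64 := by field_simp; ring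
      push_cast
      linarith
    calc 1 ≤ (5 * ℓ) * (ε * y ^ 2) * y := by
          have : 1 ≤ 5 * ℓ := by linarith
          have := one_le_mul_of_one_le_of_one_le (one_le_mul_of_one_le_of_one_le this hε.le) hy1
          exact this
      _ = ε / 8 * κ * n ^ 2 := by
          rw [← hy] at hnκ ⊢; linear_combination (-(ε * y ^ 3 / 8)) * hnκ
      _ ≤ _ := by gcongr
  · refine le_trans (pow_le_pow_left₀ (by
      have : 0 < 1 - p := by linarith
      positivity) ?_ 4) hLy4
    refine le_trans ?_ hκε
    -- This gives the base `32 κ / ((ε/8) (1/4)) = 1024 κ / ε`. With `κ = 40ℓ/n` the constant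
    -- becomes `40960`.
    have h1 : (1 : ℝ) / 4 ≤ r * (1 - p) := by nlinarith
    calc 32 * κ / (ε / 8 * r * (1 - p)) = 32 * κ / (ε / 8 * (r * (1 - p))) := by rw [mul_assoc]
      _ ≤ 32 * κ / (ε / 8 * (1 / 4)) := by gcongr
      _ = _ := by field_simp; norm_num
  · have h1 : (289 : ℝ) ≤ n := by linarith
    have : 289 ≤ n := by exact_mod_cast h1
    omega
  · exact fun N hN => many_params hL hε0 hε1 hLn hn0 hn1 hexpℓ hℓL hℓ2 hr0 hrge hκ0 hnκ hk₀2 hmε hN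

/-- The protocol with suitable parameters, for small `ε` and large `n`. -/
theorem exists_params {n : ℕ} {ε y : ℝ} (hy0 : 0 < y) (hy : y ^ 3 = n)
    (hL : 10 ≤ Real.log n) (hLy : 16 * (40960 * Real.log n) ^ 4 ≤ y ^ 2)
    (hε : 1 < ε * y ^ 2) (hε0 : 0 < ε) (hε1 : ε ≤ 1 / 10) :
    ∃ (m : ℕ) (s : ℝ) (p : ℝ≥0) (hp : p ≤ 1), 1 < s ∧
      (binarySummation n (2 * m + 1) s p hp).IsShuffledDP n ε ∧
      ((2 * m + 1 : ℕ) : ℝ) ≤ 403 * (Real.log n / ε) ∧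
      ∀ x : Fin n → Bool, (binarySummation n (2 * m + 1) s p hp).expectedError x ≤
        ENNReal.ofReal ((160 * 64 ^ 3 + 2560 ^ 2) *
          (Real.sqrt (Real.log (1 / ε)) / ε ^ ((3 : ℝ) / 2))) := by
  set L := Real.log n with hLdef
  set ℓ := Real.log (1 / ε) with hℓdef
  have hLpow : 40960 * L ≤ (40960 * L) ^ 4 := le_self_pow₀ (by linarith) (by norm_num)
  have hy2 : 16 * (40960 * L) ≤ y ^ 2 := by linarith
  have hy1 : 1 ≤ y := by
    by_contra hcon
    have : y ^ 2 ≤ 1 := pow_le_one₀ hy0.le (by linarith)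
    linarith
  have hyn : y ^ 2 ≤ n := by rw [← hy]; exact pow_le_pow_right₀ hy1 (by norm_num)
  have hLn : 16 * (40960 * L) ≤ n := hy2.trans hyn
  have hn0 : (0 : ℝ) < n := by linarith
  have hεn : 1 / ε ≤ n := by
    rw [div_le_iff₀ hε0]
    nlinarith
  have hℓL : ℓ ≤ L := Real.log_le_log (by positivity) hεn
  have hℓ2 : 9 / 4 ≤ ℓ := by
    have h10 : (10 : ℝ) ≤ 1 / ε := by rw [le_div_iff₀ hε0]; linarith
    have : Real.exp (9 / 4) ≤ 10 := by
      have h1 := Real.exp_one_lt_d9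
      have h2 : Real.exp (9 / 4) ^ 4 = Real.exp 1 ^ 9 := by
        rw [← Real.exp_nat_mul, ← Real.exp_nat_mul]; norm_num
      have h3 : Real.exp 1 ^ 9 ≤ 10 ^ 4 := by
        calc Real.exp 1 ^ 9 ≤ 2.7182818286 ^ 9 := by gcongr
          _ ≤ 10 ^ 4 := by norm_num
      exact le_of_pow_le_pow_left₀ (by norm_num) (by norm_num) (h2.trans_le h3)
    rw [hℓdef, Real.le_log_iff_exp_le (by positivity)]
    exact this.trans h10
  have hℓε : ℓ ≤ 1 / ε := by
    have := Real.log_le_sub_one_of_pos (x := 1 / ε) (by positivity)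
    linarith
  -- The scale is `s = 32/ε`, so a shift by one costs `r⁻¹ = e^(ε/32)`, well within `1 + δ` for `δ =
  -- ε/8`.
  set r := Real.exp (-1 / (32 / ε)) with hr
  have hrx : r = Real.exp (-(ε / 32)) := by rw [hr]; congr 1; field_simp
  have hr0 : 0 < r := Real.exp_pos _
  have hr1 : r ≤ 1 := by rw [hrx]; exact Real.exp_le_one_iff.2 (by linarith)
  have hrge : 1 - ε / 32 ≤ r := by
    rw [hrx]
    have := Real.add_one_le_exp (-(ε / 32))
    linarith
  have hrsub : ε / 64 ≤ 1 - r := by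
    have := half_le_one_sub_exp (x := ε / 32) (by linarith) (by linarith)
    rw [hrx]
    linarith
  have hrlt : r < 1 := by linarith
  -- `κ` is the probability that a user's noise equals `m`, so `40 log(1/ε)` such users are expected
  -- in total.
  set κ := 40 * ℓ / n with hκ
  have hκ0 : 0 < κ := by positivity
  have hnκ : n * κ = 40 * ℓ := by rw [hκ]; field_simp
  have hκε : 1024 * κ / ε ≤ 40960 * L / y := by
    rw [hκ, ← hy, div_le_div_iff₀ hε0 hy0, mul_div_assoc', div_mul_eq_mul_div,
      div_le_iff₀ (by positivity)]
    have h1 : ℓ * y ≤ L * y * (ε * y ^ 2) := by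
      calc ℓ * y ≤ L * y := by gcongr
        _ ≤ L * y * (ε * y ^ 2) := le_mul_of_one_le_right (by positivity) hε.le
    nlinarith
  -- The hypothesis `ε > n^(-2/3) = y⁻²` enters here: the cost per exchanged user is `O(L / y)`, and
  -- the fourth power (`h = 4`) brings it below `ε/16`.
  have hLy4 : (40960 * L / y) ^ 4 ≤ ε / 16 := by
    rw [div_pow, div_le_div_iff₀ (by positivity) (by norm_num)]
    have : y ^ 2 ≤ ε * y ^ 4 := by
      calc y ^ 2 ≤ (ε * y ^ 2) * y ^ 2 := le_mul_of_one_le_left (by positivity) hε.le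
        _ = _ := by ring
    linarith
  have hLy1 : 40960 * L / y ≤ 1 := by
    by_contra hcon
    push Not at hcon
    have := one_lt_pow₀ hcon (n := 4) (by norm_num)
    linarith
  set k₀ := ⌈20 * L⌉₊ with hk₀
  have hk₀1 : 20 * L ≤ k₀ := Nat.le_ceil _
  have hk₀2 : (k₀ : ℝ) ≤ 21 * L := by
    have := (Nat.ceil_lt_add_one (show 0 ≤ 20 * L by linarith)).le
    linarith
  set m := ⌈200 * L / ε⌉₊ with hm
  have hm1 : 200 * L / ε ≤ m := Nat.le_ceil _
  have hm2 : (m : ℝ) ≤ 200 * L / ε + 1 := (Nat.ceil_lt_add_one (by positivity)).le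
  set U := ⌊k₀ / (ε / 8)⌋₊ with hU
  have hU1 : (U : ℝ) ≤ k₀ / (ε / 8) := Nat.floor_le (by positivity)
  have hU2 : k₀ / (ε / 8) - 1 ≤ U := (Nat.sub_one_lt_floor _).le
  set G := ∑ v ∈ Finset.range (m + 1), r ^ v with hG
  have hG0 : 0 < G := Finset.sum_pos (fun v _ => by positivity) (by simp)
  have hG1 : G ≤ 64 / ε := by
    have h1 : G ≤ (1 - r)⁻¹ := sum_le_hasSum _ (fun v _ => by positivity)
      (hasSum_geometric_of_norm_lt_one (by rwa [Real.norm_of_nonneg hr0.le]))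
    refine h1.trans ?_
    rw [← inv_div]
    exact inv_anti₀ (by positivity) hrsub
  have hp8 : κ * (2 * G) ≤ 1 / 8 := by
    calc κ * (2 * G) ≤ κ * (2 * (64 / ε)) := by gcongr
      _ = (1024 * κ / ε) / 8 := by ring
      _ ≤ _ := by linarith
  have hexpL : Real.exp L = n := Real.exp_log hn0
  obtain ⟨p, hpdef⟩ : ∃ p : ℝ≥0, (p : ℝ) = κ * (2 * G) := ⟨⟨κ * (2 * G), by positivity⟩, rfl⟩
  have hp : p ≤ 1 := by
    have : (p : ℝ) ≤ 1 := by linarith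
    exact_mod_cast this
  have hκp : κ = p / (2 * G) := by rw [hpdef]; field_simp
  have hn1 : (1 : ℕ) ≤ n := by
    have : (1 : ℝ) ≤ n := by linarith
    exact_mod_cast this
  have hgood : GoodParams (n - 1) m k₀ U 4 r κ (1 - p) (ε / 8) (ε / 16) :=
    goodParams_of hy hL hy1 hε hε0 hε1 hLn hn0 hn1 hεn hexpL (Real.exp_log (by positivity))
      hℓL hℓ2 hr0 hr1 hrge hκ0 hnκ hκε hLy4 p.coe_nonneg (hpdef.trans_le hp8) hk₀1 hk₀2 hm1 hm2
      hU1 hU2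
  refine ⟨m, 32 / ε, p, hp, ?_, ?_, ?_, ?_⟩
  · rw [lt_div_iff₀ hε0]; linarith
  · exact binarySummation_isShuffledDP hp hr hκp rfl hgood (by linarith) le_rfl
  · have : 1 ≤ L / ε := by rw [le_div_iff₀ hε0]; linarith
    push_cast
    rw [mul_div_assoc] at hm2
    linarith
  · intro x
    have hε32 : 0 < ε ^ ((3 : ℝ) / 2) := by positivity
    have hsq : (Real.sqrt ℓ / ε ^ ((3 : ℝ) / 2)) ^ 2 = ℓ / ε ^ 3 := by
      rw [div_pow, Real.sq_sqrt (by linarith), ← Real.rpow_natCast (ε ^ _), ← Real.rpow_mul hε0.le,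
        ← Real.rpow_natCast ε]
      norm_num
    set t := Real.sqrt ℓ / ε ^ ((3 : ℝ) / 2) with ht
    have ht0 : 0 < t := div_pos (Real.sqrt_pos.2 (by linarith)) hε32
    refine (expectedError_le hp (by positivity) hr hκp x ht0).trans (ENNReal.ofReal_le_ofReal ?_)
    have hinv : 1 / (1 - r) ≤ 64 / ε := by
      rw [one_div, ← inv_div]
      exact inv_anti₀ (by positivity) hrsub
    have hM : n * (4 * κ / (1 - r) ^ 3) + (n * (κ / (1 - r))) ^ 2 ≤
        (160 * 64 ^ 3 + 2560 ^ 2) * t ^ 2 := by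
      have hinv0 : 0 ≤ 1 / (1 - r) := by
        have : 0 < 1 - r := by linarith
        positivity
      calc n * (4 * κ / (1 - r) ^ 3) + (n * (κ / (1 - r))) ^ 2
          = 4 * (n * κ) * (1 / (1 - r)) ^ 3 + (n * κ) ^ 2 * (1 / (1 - r)) ^ 2 := by
            have h3 : 4 * κ / (1 - r) ^ 3 = 4 * κ * (1 / (1 - r)) ^ 3 := by rw [one_div_pow]; ring
            have h1 : κ / (1 - r) = κ * (1 / (1 - r)) := by ring
            rw [h3, h1]
            ring
        _ ≤ 4 * (n * κ) * (64 / ε) ^ 3 + (n * κ) ^ 2 * (64 / ε) ^ 2 := by gcongr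
        _ = 160 * 64 ^ 3 * (ℓ / ε ^ 3) + 2560 ^ 2 * (ℓ * ℓ / ε ^ 2) := by
            rw [hnκ]; ring
        -- The squared bias is dominated by the variance scale because `log(1/ε) ≤ 1/ε`.
        _ ≤ 160 * 64 ^ 3 * (ℓ / ε ^ 3) + 2560 ^ 2 * (ℓ * (1 / ε) / ε ^ 2) := by gcongr
        _ = _ := by rw [hsq]; field_simp
    have hMt : (n * (4 * κ / (1 - r) ^ 3) + (n * (κ / (1 - r))) ^ 2) / t ≤
        (160 * 64 ^ 3 + 2560 ^ 2) * t := by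
      rw [div_le_iff₀ ht0]
      calc _ ≤ _ := hM
        _ = _ := by ring
    linarith

theorem IsPureDP.mono {X Y : Type*} {n : ℕ} {ε ε' : ℝ} {M : (Fin n → X) → PMF Y}
    (h : IsPureDP ε M) (hε : ε ≤ ε') : IsPureDP ε' M := fun x x' hx S =>
  (h x x' hx S).trans (by gcongr)

end ShuffledDP

theorem theorem3p1 :
    ∃ n₀ : ℕ, ∀ C : ℝ, 0 < C → ∃ K : ℝ, 0 < K ∧
      ∀ n : ℕ, n₀ ≤ n → ∀ ε : ℝ, 1 / (n : ℝ) ^ ((2 : ℝ) / 3) < ε → ε ≤ C →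
        ∃ (d : ℕ) (s : ℝ) (p : ℝ≥0) (hp : p ≤ 1), Odd d ∧ 1 < s ∧
          (ShuffledDP.binarySummation n d s p hp).IsShuffledDP n ε ∧
          (ShuffledDP.binarySummation n d s p hp).Sends d ∧
          (d : ℝ) ≤ K * (Real.log n / ε) ∧
          ∀ x : Fin n → Bool,
            (ShuffledDP.binarySummation n d s p hp).expectedError x ≤
              ENNReal.ofReal
                (K * (Real.sqrt (max 1 (Real.log (1 / ε))) / ε ^ ((3 : ℝ) / 2))) := by
  obtain ⟨n₁, hn₁⟩ := ShuffledDP.eventually_log_le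
  refine ⟨n₁, fun C hC => ?_⟩
  set K₁ : ℝ := 160 * 64 ^ 3 + 2560 ^ 2 with hK₁
  set B : ℝ := Real.sqrt (Real.log 10) / (1 / 10 : ℝ) ^ ((3 : ℝ) / 2) with hB
  have hB0 : 0 ≤ B := by positivity
  have hC32 : 0 < C ^ ((3 : ℝ) / 2) := by positivity
  -- `K₁` serves `ε ≤ 1/10`. The other two terms bound the message number and the error of the
  -- protocol for `1/10` when `1/10 < ε ≤ C`.
  refine ⟨K₁ + 4030 * C + K₁ * B * C ^ ((3 : ℝ) / 2), by positivity, fun n hn ε hε hεC => ?_⟩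
  have hCC : 0 ≤ K₁ * B * C ^ ((3 : ℝ) / 2) := by positivity
  obtain ⟨hL, hLy⟩ := hn₁ n hn
  have hn0 : (0 : ℝ) < n := by
    rcases Nat.eq_zero_or_pos n with rfl | h
    · simp at hL; linarith
    · exact_mod_cast h
  set y := (n : ℝ) ^ ((1 : ℝ) / 3) with hy
  have hy0 : 0 < y := by positivity
  have hy2 : (n : ℝ) ^ ((2 : ℝ) / 3) = y ^ 2 := by
    rw [hy, ← Real.rpow_natCast, ← Real.rpow_mul hn0.le]; norm_num
  have hy3 : y ^ 3 = n := by
    rw [hy, ← Real.rpow_natCast, ← Real.rpow_mul hn0.le]; norm_num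
  rw [hy2] at hε
  have hε0 : 0 < ε := lt_trans (by positivity) hε
  rw [div_lt_iff₀ (by positivity)] at hε
  have hLε : 0 ≤ Real.log n / ε := div_nonneg (by linarith) hε0.le
  by_cases h10 : ε ≤ 1 / 10
  · obtain ⟨m, s, p, hp, hs, hdp, hd, herr⟩ :=
      ShuffledDP.exists_params hy0 hy3 hL hLy hε hε0 h10
    refine ⟨2 * m + 1, s, p, hp, ⟨m, rfl⟩, hs, hdp, ShuffledDP.binarySummation_sends n m s p hp,
      hd.trans ?_, fun x => (herr x).trans (ENNReal.ofReal_le_ofReal ?_)⟩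
    · gcongr
      rw [hK₁]
      linarith
    · exact mul_le_mul (by linarith) (by gcongr; exact le_max_right _ _) (by positivity)
        (by positivity)
  -- For `ε > 1/10` the protocol for `1/10` is used: privacy is monotone in `ε`, and its fixed error
  -- `K₁ B` is compensated by the factor `C^(3/2)` in the constant.
  · push Not at h10
    have hy10 : 1 < 1 / 10 * y ^ 2 := by
      have : (10 : ℝ) ^ 4 ≤ Real.log n ^ 4 := by gcongr
      rw [mul_pow] at hLy
      linarith
    obtain ⟨m, s, p, hp, hs, hdp, hd, herr⟩ :=
      ShuffledDP.exists_params hy0 hy3 hL hLy hy10 (by norm_num) le_rfl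
    refine ⟨2 * m + 1, s, p, hp, ⟨m, rfl⟩, hs, hdp.mono h10.le,
      ShuffledDP.binarySummation_sends n m s p hp, hd.trans ?_,
      fun x => (herr x).trans (ENNReal.ofReal_le_ofReal ?_)⟩
    · calc 403 * (Real.log n / (1 / 10)) = 4030 * ε * (Real.log n / ε) := by
            field_simp; norm_num
        _ ≤ _ := by
            gcongr
            have : 4030 * ε ≤ 4030 * C := by gcongr
            have : 0 ≤ K₁ := by positivity
            linarith
    · have h1 : 1 ≤ Real.sqrt (max 1 (Real.log (1 / ε))) :=
        Real.one_le_sqrt.2 (le_max_left _ _)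
      have h2 : (1 / C ^ ((3 : ℝ) / 2)) ≤
          Real.sqrt (max 1 (Real.log (1 / ε))) / ε ^ ((3 : ℝ) / 2) := by gcongr
      have h3 : Real.sqrt (Real.log (1 / (1 / 10))) / (1 / 10 : ℝ) ^ ((3 : ℝ) / 2) = B := by
        rw [hB]; norm_num
      rw [h3]
      calc K₁ * B = K₁ * B * C ^ ((3 : ℝ) / 2) * (1 / C ^ ((3 : ℝ) / 2)) := by field_simp
        _ ≤ (K₁ + 4030 * C + K₁ * B * C ^ ((3 : ℝ) / 2)) * (1 / C ^ ((3 : ℝ) / 2)) := by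
            gcongr
            have : 0 ≤ K₁ + 4030 * C := by positivity
            linarith
        _ ≤ _ := by gcongr
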